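/- Let $p\ge 0$ be an integer, let $\operatorname{Sym}(p)$ be the space of symmetric $p\times p$ real matrices, let $\mathbb P(p)\subset\operatorname{Sym}(p)$ be the set of positive-definite ones, and let $\omega=(\mu,\Sigma)\in\Omega=\mathbb R^p\times\mathbb P(p)$. Put $m=\dim\Omega=\dim(\mathbb R^p\times\operatorname{Sym}(p))=p(p+3)/2$, and identify $\omega$ with the vector $(\omega_1,\dots,\omega_m)=(\mu,\operatorname{vech}\Sigma)\in\mathbb R^m$ formed by the entries of $\mu$ and the entries of $\Sigma$ on and below the diagonal. Let $\Theta_{1},\Theta_{2},\dots$ be independent random vectors with distribution $\mathcal N_p(\mu,\Sigma)$, and for each $n$ let $\hat\omega_n=(\hat\mu_n,\hat\Sigma_n)$ be a maximum likelihood estimator from $\Theta_{1},\dots,\Theta_{n}$: a random element which, almost surely, maximizes the likelihood $\prod_{i=1}^n \mathcal N_p(\Theta_{i}\mid\cdot,\cdot)$ over $\Omega$ whenever a maximizer exists, where $\mathcal N_p(\cdot\mid\mu,\Sigma)$ also denotes the normal density. Let $$I(\omega)=\operatorname{Cov}_{x\sim\mathcal N_p(\mu,\Sigma)}\bigl[\nabla_\omega\log\mathcal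 N_p(x\mid\mu,\Sigma)\bigr]$$ be the Fisher information matrix. Then the log-density is differentiable in the coordinates of $\omega$ at $\omega$, the score is square-integrable, $I(\omega)$ is positive definite (hence invertible), its entries are $$I_{ij}(\omega)=\Bigl[\frac{\partial\mu}{\partial\omega_i}\Bigr]^\top\Sigma^{-1}\frac{\partial\mu}{\partial\omega_j}+\frac12\operatorname{tr}\Bigl(\Sigma^{-1}\frac{\partial\Sigma}{\partial\omega_i}\Sigma^{-1}\frac{\partial\Sigma}{\partial\omega_j}\Bigr),$$ and, as $n\to\infty$, $$\sqrt n\,(\hat\omega_n-\omega)\xrightarrow{d}\mathcal N_m\bigl(0,I(\omega)^{-1}\bigr).$$ -/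

import Mathlib

open MeasureTheory ProbabilityTheory Filter Topology
open scoped Matrix

noncomputable section

namespace GaussianML

/-- The real vector space of symmetric `p × p` real matrices. -/
def symMatrices (p : ℕ) : Submodule ℝ (Matrix (Fin p) (Fin p) ℝ) where
  carrier := {M | M.IsSymm}
  add_mem' := fun ha hb => Matrix.IsSymm.add ha hb
  zero_mem' := Matrix.isSymm_zero
  smul_mem' := fun c _ hM => Matrix.IsSymm.smul hM c

/-- The parameter set `ℝᵖ × ℙ(p)`: pairs of a mean vector and a symmetric positive-definite
matrix. -/
def paramSet (p : ℕ) : Set (EuclideanSpace ℝ (Fin p) × Matrix (Fin p) (Fin p) ℝ) :=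
  {θ | θ.2.PosDef}

/-- Indices of the free coordinates of `(μ, Σ)`: the `p` entries of `μ`, then the entries of `Σ`
on and below the diagonal (half-vectorization). -/
abbrev ParamIndex (p : ℕ) : Type :=
  Fin p ⊕ {ij : Fin p × Fin p // ij.2 ≤ ij.1}

/-- The coordinate vector `(μ, vech Σ)` of a pair `(μ, Σ)`. -/
def paramVec {p : ℕ} (θ : EuclideanSpace ℝ (Fin p) × Matrix (Fin p) (Fin p) ℝ) :
    EuclideanSpace ℝ (ParamIndex p) :=
  WithLp.toLp 2 (Sum.elim (fun a => θ.1 a) (fun ij => θ.2 ij.1.1 ij.1.2))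

/-- The mean vector with coordinates `ψ`. -/
def meanOf {p : ℕ} (ψ : EuclideanSpace ℝ (ParamIndex p)) : EuclideanSpace ℝ (Fin p) :=
  WithLp.toLp 2 (fun a => ψ (Sum.inl a))

/-- The symmetric matrix with coordinates `ψ`. -/
def covOf {p : ℕ} (ψ : EuclideanSpace ℝ (ParamIndex p)) : Matrix (Fin p) (Fin p) ℝ :=
  Matrix.of fun a b => ψ (Sum.inr ⟨(max a b, min a b), min_le_max⟩)

/-- The Lebesgue density of the normal distribution `N_p(μ, S)` at `x`. -/
def gaussianDensity {p : ℕ} (μ : EuclideanSpace ℝ (Fin p)) (S : Matrix (Fin p) (Fin p) ℝ)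
    (x : EuclideanSpace ℝ (Fin p)) : ℝ :=
  (Real.sqrt ((2 * Real.pi) ^ p * S.det))⁻¹ *
    Real.exp (-(1 / 2) * ((x - μ).ofLp ⬝ᵥ (S⁻¹ *ᵥ (x - μ).ofLp)))

/-- The likelihood of `θ = (μ, Σ)` given the observations `x 0, …, x (n - 1)`. -/
def likelihood {p n : ℕ} (x : Fin n → EuclideanSpace ℝ (Fin p))
    (θ : EuclideanSpace ℝ (Fin p) × Matrix (Fin p) (Fin p) ℝ) : ℝ :=
  ∏ i, gaussianDensity θ.1 θ.2 (x i)

/-- `θ` is a maximum likelihood estimate from the observations `x`: it lies in the parameter set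
and maximizes the likelihood there. -/
def IsMLEstimate {p n : ℕ} (x : Fin n → EuclideanSpace ℝ (Fin p))
    (θ : EuclideanSpace ℝ (Fin p) × Matrix (Fin p) (Fin p) ℝ) : Prop :=
  θ ∈ paramSet p ∧ IsMaxOn (likelihood x) (paramSet p) θ

/-- `est n` is, for every `n`, a maximum likelihood estimator from the first `n` of the
observations `X 0, X 1, …`: almost surely it is a maximum likelihood estimate whenever one exists
(for `n ≤ p`, `0 < n`, the likelihood is unbounded, so nothing can be asked of `est n` then). -/
def IsMLEstimator {p : ℕ} {Ω : Type*} [MeasurableSpace Ω] (P : Measure Ω)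
    (X : ℕ → Ω → EuclideanSpace ℝ (Fin p))
    (est : ℕ → Ω → EuclideanSpace ℝ (Fin p) × Matrix (Fin p) (Fin p) ℝ) : Prop :=
  ∀ n : ℕ, AEMeasurable (fun w => paramVec (est n w)) P ∧
    ∀ᵐ w ∂P, (∃ θ, IsMLEstimate (fun i : Fin n => X i w) θ) →
      IsMLEstimate (fun i : Fin n => X i w) (est n w)

/-- The partial derivative `∂f/∂ψ_i` at `ψ`. -/
def partialDeriv {p : ℕ} (f : EuclideanSpace ℝ (ParamIndex p) → ℝ)
    (ψ : EuclideanSpace ℝ (ParamIndex p)) (i : ParamIndex p) : ℝ :=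
  lineDeriv ℝ f ψ (EuclideanSpace.single i 1)

/-- The logarithm of the normal density as a function of the coordinates `ψ` of `(μ, Σ)`. -/
def logDensity {p : ℕ} (ψ : EuclideanSpace ℝ (ParamIndex p)) (x : EuclideanSpace ℝ (Fin p)) : ℝ :=
  Real.log (gaussianDensity (meanOf ψ) (covOf ψ) x)

/-- The score: the `i`-th coordinate of the gradient of the log-density in `ψ`. -/
def score {p : ℕ} (ψ : EuclideanSpace ℝ (ParamIndex p)) (i : ParamIndex p)
    (x : EuclideanSpace ℝ (Fin p)) : ℝ :=
  partialDeriv (fun ψ' => logDensity ψ' x) ψ i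

/-- The Fisher information matrix at `ψ`: the covariance matrix of the score under the normal
distribution with parameters `ψ`. -/
def fisherInfo {p : ℕ} (ψ : EuclideanSpace ℝ (ParamIndex p)) :
    Matrix (ParamIndex p) (ParamIndex p) ℝ :=
  Matrix.of fun i j =>
    covariance (score ψ i) (score ψ j) (multivariateGaussian (meanOf ψ) (covOf ψ))

/-- The vector `∂μ/∂ψ_i`. -/
def meanPartial {p : ℕ} (ψ : EuclideanSpace ℝ (ParamIndex p)) (i : ParamIndex p) : Fin p → ℝ :=
  fun a => partialDeriv (fun ψ' => meanOf ψ' a) ψ i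

/-- The matrix `∂Σ/∂ψ_i`. -/
def covPartial {p : ℕ} (ψ : EuclideanSpace ℝ (ParamIndex p)) (i : ParamIndex p) :
    Matrix (Fin p) (Fin p) ℝ :=
  Matrix.of fun a b => partialDeriv (fun ψ' => covOf ψ' a b) ψ i

end GaussianML

end

/-! ### The likelihood and its unique maximizer. -/

namespace GaussianML

/-! The estimator is explicit, so no general theory of M-estimators is needed. The log-likelihood
depends on the data only through the sample mean and the sample covariance `C`. Applying `log t ≤ t
- 1` to eigenvalues shows that, when `C` is positive definite, this pair is the only maximizer
(`isMLEstimate_iff`). By the strong law `det C` tends to `det S > 0`, so almost surely the estimator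
equals this pair for all large `n`.

The score in a direction `v` is a polynomial of degree two in `x - μ` (`lineDeriv_logDensity`).
Gaussian moments up to order four give its covariances (`covariance_quadScore`), which form a
positive-definite bilinear form `infoForm`; this is the Fisher information `I`.

The limiting covariance comes without inverting `I` by hand. The centered statistic `Z`, with
entries `x - μ` and `vech ((x - μ)(x - μ)ᵀ - S)`, represents the score: `infoForm S v Z` is the
score in direction `v` (`infoForm_centeredStat`). Hence `⟨t, Z⟩` is the score in direction `I⁻¹ t`,
with variance `tᵀ I⁻¹ I I⁻¹ t = tᵀ I⁻¹ t`, and the central limit theorem applies to `Z`.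

Finally, the error of the sample pair is exactly `sampleMap z z`, where `z` is the average of the
`Z`'s. As `sampleMap` is homogeneous in its first argument and `sampleMap w 0 = w`, Slutsky's
theorem transfers the limit of `√n z` to the estimator. -/

open scoped MatrixOrder in
theorem _root_.Matrix.PosDef.exists_transpose_mul_self {n : Type*} [Fintype n] [DecidableEq n]
    {A : Matrix n n ℝ} (hA : A.PosDef) : ∃ B : Matrix n n ℝ, IsUnit B.det ∧ A = Bᵀ * B := by
  obtain ⟨B, hB⟩ := CStarAlgebra.nonneg_iff_eq_star_mul_self.mp hA.posSemidef.nonneg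
  have hB' : A = Bᵀ * B := by
    rw [hB, Matrix.star_eq_conjTranspose, Matrix.conjTranspose_eq_transpose_of_trivial]
  refine ⟨B, ?_, hB'⟩
  have h := hA.det_pos
  rw [hB', Matrix.det_mul, Matrix.det_transpose] at h
  exact isUnit_iff_ne_zero.mpr fun h0 => by simp [h0] at h

/-- `log det M ≤ tr M - n` for positive-definite `M`, with equality only at the identity. -/
theorem _root_.Matrix.PosDef.log_det_add_card_le_trace {n : Type*} [Fintype n] [DecidableEq n]
    {M : Matrix n n ℝ} (hM : M.PosDef) :
    Real.log M.det + Fintype.card n ≤ M.trace ∧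
      (Real.log M.det + Fintype.card n = M.trace → M = 1) := by
  have hpos := hM.eigenvalues_pos
  have hdet : Real.log M.det = ∑ i, Real.log (hM.1.eigenvalues i) := by
    rw [hM.1.det_eq_prod_eigenvalues]
    simp only [RCLike.ofReal_real_eq_id, id]
    exact Real.log_prod fun i _ => (hpos i).ne'
  have htr : M.trace = ∑ i, hM.1.eigenvalues i := by
    simpa using hM.1.trace_eq_sum_eigenvalues
  have hsum : Real.log M.det + Fintype.card n = ∑ i, (Real.log (hM.1.eigenvalues i) + 1) := by
    rw [hdet, Finset.sum_add_distrib]; simp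
  have hle : ∀ i, Real.log (hM.1.eigenvalues i) + 1 ≤ hM.1.eigenvalues i := fun i => by
    linarith [Real.log_le_sub_one_of_pos (hpos i)]
  rw [hsum, htr]
  refine ⟨Finset.sum_le_sum fun i _ => hle i, fun h => ?_⟩
  have hone : ∀ i, hM.1.eigenvalues i = 1 := fun i => by
    have hi := (Finset.sum_eq_sum_iff_of_le fun i _ => hle i).mp h i (Finset.mem_univ i)
    by_contra hne
    linarith [Real.log_lt_sub_one_of_pos (hpos i) hne]
  have hspec := hM.1.spectral_theorem
  have hdiag : Matrix.diagonal (RCLike.ofReal ∘ hM.1.eigenvalues) = (1 : Matrix n n ℝ) := by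
    rw [← Matrix.diagonal_one]
    congr 1
    funext i
    simp [hone i]
  rw [hdiag, map_one] at hspec
  exact hspec

/-- Writing `T⁻¹ = Bᵀ B`, the matrix `B C Bᵀ` is positive definite and has the determinant and trace
of `T⁻¹ C`, so the one-matrix inequality applies to it. Equality forces `B C Bᵀ = 1`, that is, `C =
T`. -/
theorem _root_.Matrix.PosDef.log_det_add_card_le {n : Type*} [Fintype n] [DecidableEq n]
    {C T : Matrix n n ℝ} (hC : C.PosDef) (hT : T.PosDef) :
    Real.log C.det + Fintype.card n ≤ Real.log T.det + (T⁻¹ * C).trace ∧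
      (Real.log C.det + Fintype.card n = Real.log T.det + (T⁻¹ * C).trace → T = C) := by
  obtain ⟨B, hBu, hB⟩ := hT.inv.exists_transpose_mul_self
  have hBu' : IsUnit B := (Matrix.isUnit_iff_isUnit_det B).mpr hBu
  have hM : (B * C * Bᵀ).PosDef := by
    have := (Matrix.IsUnit.posDef_star_right_conjugate_iff hBu' (x := C)).mpr hC
    rwa [Matrix.star_eq_conjTranspose, Matrix.conjTranspose_eq_transpose_of_trivial] at this
  have hTdet : T.det ≠ 0 := hT.det_pos.ne'
  have hTinv : T⁻¹.det = T.det⁻¹ := by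
    rw [Matrix.det_nonsing_inv, Ring.inverse_eq_inv']
  have hdet : Real.log (B * C * Bᵀ).det = Real.log C.det - Real.log T.det := by
    have : (B * C * Bᵀ).det = C.det * T.det⁻¹ := by
      rw [← hTinv, hB]; simp only [Matrix.det_mul]; ring
    rw [this, Real.log_mul hC.det_pos.ne' (inv_ne_zero hTdet), Real.log_inv]; ring
  have htr : (B * C * Bᵀ).trace = (T⁻¹ * C).trace := by
    rw [hB, Matrix.trace_mul_cycle]
  obtain ⟨h1, h2⟩ := hM.log_det_add_card_le_trace
  rw [hdet, htr] at h1 h2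
  refine ⟨by linarith, fun h => ?_⟩
  have hone := h2 (by linarith)
  have hCB : C * (Bᵀ * B) = 1 := by
    have h3 : (Bᵀ * (B * C) - 1) * Bᵀ = 0 := by
      rw [sub_mul, one_mul, Matrix.mul_assoc, hone, mul_one, sub_self]
    have h4 : Bᵀ * (B * C) - 1 = 0 := by
      have hu : IsUnit Bᵀ := (Matrix.isUnit_transpose B).mpr hBu'
      exact (hu.mul_left_eq_zero).mp h3
    rw [mul_eq_one_comm, Matrix.mul_assoc]
    exact sub_eq_zero.mp h4
  rw [← hB] at hCB
  have := Matrix.inv_eq_left_inv hCB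
  rwa [Matrix.nonsing_inv_nonsing_inv _ (isUnit_iff_ne_zero.mpr hTdet)] at this

variable {p n : ℕ}

/-- The sample mean. -/
noncomputable def sampleMean (x : Fin n → EuclideanSpace ℝ (Fin p)) : EuclideanSpace ℝ (Fin p) :=
  (n : ℝ)⁻¹ • ∑ i, x i

/-- The sample covariance matrix, normalized by the sample size. -/
noncomputable def sampleCov (x : Fin n → EuclideanSpace ℝ (Fin p)) : Matrix (Fin p) (Fin p) ℝ :=
  (n : ℝ)⁻¹ • ∑ i, Matrix.vecMulVec (x i - sampleMean x).ofLp (x i - sampleMean x).ofLp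

theorem sum_sub_sampleMean (hn : n ≠ 0) (x : Fin n → EuclideanSpace ℝ (Fin p)) :
    ∑ i, (x i - sampleMean x) = 0 := by
  have : (n : ℝ) ≠ 0 := by exact_mod_cast hn
  rw [Finset.sum_sub_distrib, sampleMean, Finset.sum_const, Finset.card_univ, Fintype.card_fin,
    ← Nat.cast_smul_eq_nsmul ℝ, smul_smul, mul_inv_cancel₀ this, one_smul, sub_self]

theorem trace_mul_vecMulVec (A : Matrix (Fin p) (Fin p) ℝ) (u v : Fin p → ℝ) :
    (A * Matrix.vecMulVec u v).trace = v ⬝ᵥ (A *ᵥ u) := by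
  rw [Matrix.mul_vecMulVec, Matrix.trace_vecMulVec, dotProduct_comm]

/-- Splitting each deviation at the sample mean kills the cross terms. `A` need not be symmetric; a
matrix unit is substituted for it later. -/
theorem sum_quadraticForm (hn : n ≠ 0) (x : Fin n → EuclideanSpace ℝ (Fin p))
    (ν : EuclideanSpace ℝ (Fin p)) (A : Matrix (Fin p) (Fin p) ℝ) :
    ∑ i, (x i - ν).ofLp ⬝ᵥ (A *ᵥ (x i - ν).ofLp) =
      n * ((A * sampleCov x).trace +
        (sampleMean x - ν).ofLp ⬝ᵥ (A *ᵥ (sampleMean x - ν).ofLp)) := by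
  have hn' : (n : ℝ) ≠ 0 := by exact_mod_cast hn
  set m := sampleMean x with hm
  have hsum : ∑ i, (x i - m).ofLp = 0 := by
    have := congrArg WithLp.ofLp (sum_sub_sampleMean hn x)
    simpa [WithLp.ofLp_sum] using this
  have htr : (n : ℝ) * (A * sampleCov x).trace =
      ∑ i, (x i - m).ofLp ⬝ᵥ (A *ᵥ (x i - m).ofLp) := by
    rw [sampleCov, Matrix.mul_smul, Matrix.trace_smul, smul_eq_mul, mul_inv_cancel_left₀ hn',
      Matrix.mul_sum, Matrix.trace_sum]
    simp_rw [trace_mul_vecMulVec]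
    rfl
  have hterm : ∀ i, (x i - ν).ofLp ⬝ᵥ (A *ᵥ (x i - ν).ofLp) =
      (x i - m).ofLp ⬝ᵥ (A *ᵥ (x i - m).ofLp) + (x i - m).ofLp ⬝ᵥ (A *ᵥ (m - ν).ofLp) +
      ((m - ν).ofLp ⬝ᵥ (A *ᵥ (x i - m).ofLp) + (m - ν).ofLp ⬝ᵥ (A *ᵥ (m - ν).ofLp)) := fun i => by
    have : (x i - ν).ofLp = (x i - m).ofLp + (m - ν).ofLp := by
      rw [← WithLp.ofLp_add, sub_add_sub_cancel]
    rw [this, Matrix.mulVec_add, dotProduct_add, add_dotProduct, add_dotProduct]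
    ring
  rw [mul_add, htr]
  simp_rw [hterm, Finset.sum_add_distrib]
  rw [← sum_dotProduct, ← dotProduct_sum, ← Matrix.mulVec_sum, hsum]
  simp
  ring

theorem gaussianDensity_pos {μ : EuclideanSpace ℝ (Fin p)} {T : Matrix (Fin p) (Fin p) ℝ}
    (hT : 0 < T.det) (x : EuclideanSpace ℝ (Fin p)) : 0 < gaussianDensity μ T x := by
  unfold gaussianDensity; positivity

theorem log_gaussianDensity {μ : EuclideanSpace ℝ (Fin p)} {T : Matrix (Fin p) (Fin p) ℝ}
    (hT : 0 < T.det) (x : EuclideanSpace ℝ (Fin p)) :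
    Real.log (gaussianDensity μ T x) =
      -(1 / 2) * (Real.log ((2 * Real.pi) ^ p) + Real.log T.det +
        (x - μ).ofLp ⬝ᵥ (T⁻¹ *ᵥ (x - μ).ofLp)) := by
  have h2 : (0 : ℝ) < (2 * Real.pi) ^ p := by positivity
  rw [gaussianDensity, Real.log_mul (by positivity) (Real.exp_pos _).ne', Real.log_exp,
    Real.log_inv, Real.log_sqrt (by positivity), Real.log_mul h2.ne' hT.ne']
  ring

theorem log_likelihood (hn : n ≠ 0) (x : Fin n → EuclideanSpace ℝ (Fin p))
    {θ : EuclideanSpace ℝ (Fin p) × Matrix (Fin p) (Fin p) ℝ} (hθ : θ ∈ paramSet p) :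
    0 < likelihood x θ ∧ Real.log (likelihood x θ) =
      -(n / 2) * (Real.log ((2 * Real.pi) ^ p) + (Real.log θ.2.det + (θ.2⁻¹ * sampleCov x).trace) +
        (sampleMean x - θ.1).ofLp ⬝ᵥ (θ.2⁻¹ *ᵥ (sampleMean x - θ.1).ofLp)) := by
  have hT : 0 < θ.2.det := Matrix.PosDef.det_pos hθ
  refine ⟨Finset.prod_pos fun i _ => gaussianDensity_pos hT _, ?_⟩
  rw [likelihood, Real.log_prod fun i _ => (gaussianDensity_pos hT _).ne']
  simp_rw [log_gaussianDensity hT]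
  rw [← Finset.mul_sum, Finset.sum_add_distrib, sum_quadraticForm hn]
  simp
  ring

/-- If the sample covariance matrix is positive definite, then the sample mean and the sample
covariance matrix form the unique maximum likelihood estimate. -/
theorem isMLEstimate_iff (hn : n ≠ 0) (x : Fin n → EuclideanSpace ℝ (Fin p))
    (hC : (sampleCov x).PosDef) (θ : EuclideanSpace ℝ (Fin p) × Matrix (Fin p) (Fin p) ℝ) :
    IsMLEstimate x θ ↔ θ = (sampleMean x, sampleCov x) := by
  have hn' : (0 : ℝ) < n := by exact_mod_cast Nat.pos_of_ne_zero hn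
  have hmem : (sampleMean x, sampleCov x) ∈ paramSet p := hC
  obtain ⟨hpos0, hlog0⟩ := log_likelihood hn x hmem
  simp only [sub_self, WithLp.ofLp_zero, zero_dotProduct, add_zero,
    Matrix.nonsing_inv_mul _ (isUnit_iff_ne_zero.mpr hC.det_pos.ne'), Matrix.trace_one] at hlog0
  have hquad : ∀ η : EuclideanSpace ℝ (Fin p) × Matrix (Fin p) (Fin p) ℝ, η ∈ paramSet p →
      0 ≤ (sampleMean x - η.1).ofLp ⬝ᵥ (η.2⁻¹ *ᵥ (sampleMean x - η.1).ofLp) := fun η hη => by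
    simpa using (Matrix.PosDef.inv hη).posSemidef.dotProduct_mulVec_nonneg (sampleMean x - η.1).ofLp
  constructor
  · rintro ⟨hθ, hmax⟩
    obtain ⟨hpos, hlog⟩ := log_likelihood hn x hθ
    have hge := Real.log_le_log hpos0 (hmax hmem)
    rw [hlog0, hlog] at hge
    obtain ⟨h1, h2⟩ := hC.log_det_add_card_le hθ
    have h3 := hquad θ hθ
    have h4 : (Real.log θ.2.det + (θ.2⁻¹ * sampleCov x).trace) +
        (sampleMean x - θ.1).ofLp ⬝ᵥ (θ.2⁻¹ *ᵥ (sampleMean x - θ.1).ofLp) ≤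
        Real.log (sampleCov x).det + Fintype.card (Fin p) := by
      by_contra hlt
      push Not at hlt
      nlinarith
    -- The log-determinant gap and the quadratic form are both nonnegative and their sum is at most
    -- zero, so both vanish.
    have hcov : θ.2 = sampleCov x := h2 (by linarith)
    have hmean : sampleMean x - θ.1 = 0 := by
      by_contra hne
      have hne' : (sampleMean x - θ.1).ofLp ≠ 0 := fun h => hne (by ext i; simpa using congrFun h i)
      have := (Matrix.PosDef.inv hθ).dotProduct_mulVec_pos hne'
      simp only [star_trivial] at this
      linarith
    exact Prod.ext (sub_eq_zero.mp hmean).symm hcov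
  · rintro rfl
    refine ⟨hmem, fun η hη => ?_⟩
    obtain ⟨hpos, hlog⟩ := log_likelihood hn x hη
    refine (Real.log_le_log_iff hpos hpos0).mp ?_
    rw [hlog0, hlog]
    have h1 := (hC.log_det_add_card_le hη).1
    have h3 := hquad η hη
    nlinarith

theorem posSemidef_sampleCov (x : Fin n → EuclideanSpace ℝ (Fin p)) :
    (sampleCov x).PosSemidef := by
  refine Matrix.PosSemidef.smul (Matrix.posSemidef_sum _ fun i _ => ?_) (by positivity)
  simpa using Matrix.posSemidef_vecMulVec_self_star (x i - sampleMean x).ofLp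

/-- A sample covariance is always positive semidefinite. Only the nonvanishing of one continuous
function then has to be obtained from the law of large numbers. -/
theorem posDef_sampleCov_iff (x : Fin n → EuclideanSpace ℝ (Fin p)) :
    (sampleCov x).PosDef ↔ (sampleCov x).det ≠ 0 := by
  rw [(posSemidef_sampleCov x).posDef_iff_isUnit, Matrix.isUnit_iff_isUnit_det,
    isUnit_iff_ne_zero]

end GaussianML

/-! ### Coordinates on the parameter space and derivatives of the log-density. -/

namespace GaussianML

variable {p : ℕ}

/-- `meanOf` as a linear map. -/
def meanLin (p : ℕ) : EuclideanSpace ℝ (ParamIndex p) →ₗ[ℝ] EuclideanSpace ℝ (Fin p) where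
  toFun := meanOf
  map_add' _ _ := by ext; simp [meanOf]
  map_smul' _ _ := by ext; simp [meanOf]

/-- `covOf` as a linear map. -/
def covLin (p : ℕ) : EuclideanSpace ℝ (ParamIndex p) →ₗ[ℝ] Matrix (Fin p) (Fin p) ℝ where
  toFun := covOf
  map_add' _ _ := by ext; simp [covOf]
  map_smul' _ _ := by ext; simp [covOf]

theorem meanOf_add_smul (ψ v : EuclideanSpace ℝ (ParamIndex p)) (t : ℝ) :
    meanOf (ψ + t • v) = meanOf ψ + t • meanOf v := by
  rw [← show meanLin p _ = meanOf _ from rfl, map_add, map_smul]; rfl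

theorem covOf_add_smul (ψ v : EuclideanSpace ℝ (ParamIndex p)) (t : ℝ) :
    covOf (ψ + t • v) = covOf ψ + t • covOf v := by
  rw [← show covLin p _ = covOf _ from rfl, map_add, map_smul]; rfl

@[simp] theorem meanOf_paramVec (θ : EuclideanSpace ℝ (Fin p) × Matrix (Fin p) (Fin p) ℝ) :
    meanOf (paramVec θ) = θ.1 := by
  ext; simp [meanOf, paramVec]

theorem covOf_paramVec {θ : EuclideanSpace ℝ (Fin p) × Matrix (Fin p) (Fin p) ℝ}
    (h : θ.2.IsSymm) : covOf (paramVec θ) = θ.2 := by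
  ext a b
  rcases le_total a b with hab | hab
  · simpa [covOf, paramVec, hab] using (h.apply a b)
  · simp [covOf, paramVec, hab]

theorem isSymm_covOf (ψ : EuclideanSpace ℝ (ParamIndex p)) : (covOf ψ).IsSymm := by
  ext a b
  simp [covOf, max_comm, min_comm]

theorem paramVec_meanOf_covOf (ψ : EuclideanSpace ℝ (ParamIndex p)) :
    paramVec (meanOf ψ, covOf ψ) = ψ := by
  ext k
  rcases k with a | ⟨⟨a, b⟩, hab⟩
  · simp [meanOf, paramVec]
  · simp only at hab
    simp [paramVec, covOf, hab]

/-- The coordinates `(μ, vech Σ)` identify `ℝᵖ × Sym(p)` with a Euclidean space. -/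
def paramEquiv (p : ℕ) :
    (EuclideanSpace ℝ (Fin p) × symMatrices p) ≃ₗ[ℝ] EuclideanSpace ℝ (ParamIndex p) where
  toFun θ := paramVec (θ.1, θ.2.1)
  map_add' _ _ := by ext k; rcases k with a | a <;> simp [paramVec]
  map_smul' _ _ := by ext k; rcases k with a | a <;> simp [paramVec]
  invFun ψ := (meanOf ψ, ⟨covOf ψ, isSymm_covOf ψ⟩)
  left_inv θ := Prod.ext (meanOf_paramVec _) (Subtype.ext (covOf_paramVec θ.2.2))
  right_inv ψ := paramVec_meanOf_covOf ψ

theorem card_paramIndex (p : ℕ) : Fintype.card (ParamIndex p) = p * (p + 3) / 2 := by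
  have e : {ij : Fin p × Fin p // ij.2 ≤ ij.1} ≃ Σ i : Fin p, {j : Fin p // j ≤ i} :=
    { toFun := fun x => ⟨x.1.1, x.1.2, x.2⟩
      invFun := fun x => ⟨(x.1, x.2.1), x.2.2⟩
      left_inv := fun _ => rfl
      right_inv := fun _ => rfl }
  have hcard : ∀ i : Fin p, Fintype.card {j : Fin p // j ≤ i} = (i : ℕ) + 1 := fun i => by
    rw [Fintype.card_subtype, Finset.filter_ge_eq_Iic]
    exact Fin.card_Iic i
  rw [Fintype.card_sum, Fintype.card_congr e, Fintype.card_sigma, Fintype.card_fin]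
  simp_rw [hcard]
  rw [Fin.sum_univ_eq_sum_range (fun i => i + 1), Finset.sum_add_distrib]
  have h := Finset.sum_range_id_mul_two p
  simp only [Finset.sum_const, Finset.card_range, smul_eq_mul, mul_one]
  -- The sum formula contains the truncated difference `p - 1`, so `p = 0` is treated apart.
  rcases p with _ | q
  · simp
  · simp only [Nat.add_sub_cancel] at h
    have : (q + 1) * (q + 1 + 3) = (q + 1) * q + 4 * (q + 1) := by ring
    omega

theorem finrank_prod_symMatrices (p : ℕ) :
    Module.finrank ℝ (EuclideanSpace ℝ (Fin p) × symMatrices p) = p * (p + 3) / 2 := by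
  rw [(paramEquiv p).finrank_eq, finrank_euclideanSpace, card_paramIndex]

section Differentiability

variable {E : Type*} [NormedAddCommGroup E] [NormedSpace ℝ E] {n : Type*} [Fintype n]
  [DecidableEq n] {M : E → Matrix n n ℝ} {e : E}

theorem differentiableAt_det (hM : ∀ i j, DifferentiableAt ℝ (fun x => M x i j) e) :
    DifferentiableAt ℝ (fun x => (M x).det) e := by
  simp_rw [Matrix.det_apply']
  fun_prop

/-- Cramer's rule: each entry is a cofactor over the determinant. Working entrywise avoids choosing
a norm on matrices. -/
theorem differentiableAt_inv (hM : ∀ i j, DifferentiableAt ℝ (fun x => M x i j) e)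
    (h : (M e).det ≠ 0) (i j : n) : DifferentiableAt ℝ (fun x => (M x)⁻¹ i j) e := by
  simp_rw [Matrix.inv_def, Matrix.smul_apply, Ring.inverse_eq_inv', smul_eq_mul,
    Matrix.adjugate_apply]
  refine ((differentiableAt_det hM).inv h).mul (differentiableAt_det fun a b => ?_)
  by_cases ha : a = j
  · subst ha; simp
  · simpa [Matrix.updateRow_ne ha] using hM a b

end Differentiability

theorem differentiableAt_covOf (ψ : EuclideanSpace ℝ (ParamIndex p)) (a b : Fin p) :
    DifferentiableAt ℝ (fun ψ' => covOf ψ' a b) ψ := by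
  simp only [covOf, Matrix.of_apply]
  fun_prop

theorem differentiableAt_logDensity {ψ : EuclideanSpace ℝ (ParamIndex p)}
    (hψ : 0 < (covOf ψ).det) (x : EuclideanSpace ℝ (Fin p)) :
    DifferentiableAt ℝ (fun ψ' => logDensity ψ' x) ψ := by
  have hdet := differentiableAt_det (differentiableAt_covOf ψ)
  have hinv := differentiableAt_inv (differentiableAt_covOf ψ) hψ.ne'
  refine DifferentiableAt.log ?_ (gaussianDensity_pos hψ x).ne'
  have hpos : (0 : ℝ) < (2 * Real.pi) ^ p * (covOf ψ).det := by positivity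
  unfold gaussianDensity
  refine DifferentiableAt.mul ?_ (DifferentiableAt.exp ?_)
  · exact ((hdet.const_mul _).sqrt hpos.ne').inv (Real.sqrt_pos.mpr hpos).ne'
  · have hmean : ∀ a, DifferentiableAt ℝ
        (fun ψ' : EuclideanSpace ℝ (ParamIndex p) => (x - meanOf ψ').ofLp a) ψ := fun a => by
      simp only [WithLp.ofLp_sub, Pi.sub_apply, meanOf]
      fun_prop
    simp only [dotProduct, Matrix.mulVec]
    exact .const_mul (.fun_sum fun i _ => (hmean i).fun_mul
      (.fun_sum fun j _ => (hinv i j).fun_mul (hmean j))) _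

section LineDerivatives

/-- The slope at `0` is `g t` itself, so continuity of `g` suffices. -/
theorem hasDerivAt_id_mul {g : ℝ → ℝ} (hg : ContinuousAt g 0) :
    HasDerivAt (fun t => t * g t) (g 0) 0 := by
  rw [hasDerivAt_iff_tendsto_slope_zero]
  refine (hg.tendsto.mono_left nhdsWithin_le_nhds).congr' ?_
  filter_upwards [self_mem_nhdsWithin] with t ht
  have : t ≠ 0 := ht
  simp [this]

variable {n : Type*} [Fintype n] [DecidableEq n]

/-- Factor `S + tH = S (1 + t S⁻¹H)` and expand `det (1 + tA) = 1 + t tr A + t² Q(t)` with `Q` a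
polynomial. -/
theorem hasDerivAt_log_det {S : Matrix n n ℝ} (hS : S.det ≠ 0) (H : Matrix n n ℝ) :
    HasDerivAt (fun t : ℝ => Real.log (S + t • H).det) (S⁻¹ * H).trace 0 := by
  have hu : IsUnit S.det := isUnit_iff_ne_zero.mpr hS
  have hfac : ∀ t : ℝ, (S + t • H).det = S.det * (1 + t • (S⁻¹ * H)).det := fun t => by
    rw [← Matrix.det_mul, mul_add, mul_one, Matrix.mul_smul,
      Matrix.mul_nonsing_inv_cancel_left _ _ hu]
  have hder : HasDerivAt (fun t : ℝ => (1 + t • (S⁻¹ * H)).det) (S⁻¹ * H).trace 0 := by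
    set Q := (Matrix.det (1 + (Polynomial.X : Polynomial ℝ) • (S⁻¹ * H).map Polynomial.C)).divX.divX
    have h1 : (fun t : ℝ => (1 + t • (S⁻¹ * H)).det) =
        fun t => 1 + (S⁻¹ * H).trace * t + Q.eval t * t ^ 2 := by
      funext t; exact Matrix.det_one_add_smul t _
    rw [h1]
    have h2 := ((hasDerivAt_id (0 : ℝ)).const_mul (S⁻¹ * H).trace).const_add 1 |>.add
      ((Q.hasDerivAt 0).mul ((hasDerivAt_id (0 : ℝ)).pow 2))
    convert! h2 using 1
    simp
  have h0 : S.det * (1 + (0 : ℝ) • (S⁻¹ * H)).det ≠ 0 := by simpa using hS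
  simp_rw [hfac]
  convert! (hder.const_mul S.det).log h0 using 1
  field_simp
  simp

/-- The resolvent identity `(S + tH)⁻¹ = S⁻¹ - t (S + tH)⁻¹ H S⁻¹` reduces differentiation of the
inverse to its continuity. -/
theorem hasDerivAt_quadraticForm_inv {S : Matrix n n ℝ} (hS : S.det ≠ 0) (hsymm : S.IsSymm)
    (H : Matrix n n ℝ) (y m : n → ℝ) :
    HasDerivAt (fun t : ℝ => (y - t • m) ⬝ᵥ ((S + t • H)⁻¹ *ᵥ (y - t • m)))
      (-(y ⬝ᵥ ((S⁻¹ * H * S⁻¹) *ᵥ y) + 2 * (m ⬝ᵥ (S⁻¹ *ᵥ y)))) 0 := by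
  have hM : ∀ i j, DifferentiableAt ℝ (fun t : ℝ => (S + t • H) i j) 0 := fun i j => by
    simp only [Matrix.add_apply, Matrix.smul_apply]; fun_prop
  have hS0 : (S + (0 : ℝ) • H).det ≠ 0 := by simpa using hS
  have hinv : ∀ i j, ContinuousAt (fun t : ℝ => (S + t • H)⁻¹ i j) 0 := fun i j =>
    (differentiableAt_inv hM hS0 i j).continuousAt
  have hdet : ∀ᶠ t : ℝ in 𝓝 0, (S + t • H).det ≠ 0 :=
    (differentiableAt_det hM).continuousAt.eventually_ne hS0
  set G : ℝ → Matrix n n ℝ := fun t => (S + t • H)⁻¹ with hG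
  -- Chosen so that the form equals `y ⬝ S⁻¹ y - t * g t` exactly wherever `S + tH` is invertible.
  set g : ℝ → ℝ := fun t => y ⬝ᵥ ((G t * (H * S⁻¹)) *ᵥ y) + m ⬝ᵥ (G t *ᵥ y) +
    y ⬝ᵥ (G t *ᵥ m) - t * (m ⬝ᵥ (G t *ᵥ m)) with hg
  have hcont : ContinuousAt g 0 := by
    simp only [hg, dotProduct, Matrix.mulVec, Matrix.mul_apply]
    fun_prop
  have hG0 : G 0 = S⁻¹ := by simp [hG]
  have hG0T : (S⁻¹)ᵀ = S⁻¹ := by rw [Matrix.transpose_nonsing_inv, hsymm.eq]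
  have hkey := (hasDerivAt_id_mul hcont).const_sub (y ⬝ᵥ (S⁻¹ *ᵥ y))
  have hval : -g 0 = -(y ⬝ᵥ ((S⁻¹ * H * S⁻¹) *ᵥ y) + 2 * (m ⬝ᵥ (S⁻¹ *ᵥ y))) := by
    have : y ⬝ᵥ (S⁻¹ *ᵥ m) = m ⬝ᵥ (S⁻¹ *ᵥ y) := by
      rw [Matrix.dotProduct_mulVec, ← Matrix.mulVec_transpose, hG0T, dotProduct_comm]
    simp only [hg, hG0, this, Matrix.mul_assoc]
    ring
  rw [hval] at hkey
  refine hkey.congr_of_eventuallyEq ?_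
  filter_upwards [hdet] with t ht
  have hdiff : G t = S⁻¹ - t • (G t * (H * S⁻¹)) := by
    have h1 : G t * (S + t • H) = 1 := Matrix.nonsing_inv_mul _ (isUnit_iff_ne_zero.mpr ht)
    have h2 : G t * (S + t • H) * S⁻¹ = G t + t • (G t * (H * S⁻¹)) := by
      rw [mul_add, add_mul, Matrix.mul_assoc, Matrix.mul_nonsing_inv _ (isUnit_iff_ne_zero.mpr hS),
        mul_one, Matrix.mul_smul, Matrix.smul_mul, Matrix.mul_assoc]
    rw [h1, one_mul] at h2
    exact eq_sub_of_add_eq h2.symm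
  have hyy : y ⬝ᵥ (G t *ᵥ y) = y ⬝ᵥ (S⁻¹ *ᵥ y) - t * (y ⬝ᵥ ((G t * (H * S⁻¹)) *ᵥ y)) := by
    conv_lhs => rw [hdiff]
    rw [Matrix.sub_mulVec, dotProduct_sub, Matrix.smul_mulVec, dotProduct_smul, smul_eq_mul]
  change (y - t • m) ⬝ᵥ (G t *ᵥ (y - t • m)) = _
  simp only [Matrix.mulVec_sub, Matrix.mulVec_smul, dotProduct_sub, sub_dotProduct,
    dotProduct_smul, smul_dotProduct, smul_eq_mul, hyy, hg]
  ring

end LineDerivatives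

/-- The polynomial `b ⬝ y + (y ⬝ M y - tr (M S)) / 2` of degree two. -/
noncomputable def quadScore (S : Matrix (Fin p) (Fin p) ℝ) (b : Fin p → ℝ)
    (M : Matrix (Fin p) (Fin p) ℝ) (y : Fin p → ℝ) : ℝ :=
  b ⬝ᵥ y + 1 / 2 * (y ⬝ᵥ (M *ᵥ y) - (M * S).trace)

/-- Mean and covariance are affine along a line, so the two derivatives above add up. The
log-determinant contributes the constant that centers the quadratic part. -/
theorem lineDeriv_logDensity {ψ : EuclideanSpace ℝ (ParamIndex p)} (hψ : 0 < (covOf ψ).det)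
    (v : EuclideanSpace ℝ (ParamIndex p)) (x : EuclideanSpace ℝ (Fin p)) :
    lineDeriv ℝ (fun ψ' => logDensity ψ' x) ψ v =
      quadScore (covOf ψ) ((covOf ψ)⁻¹ *ᵥ (meanOf v).ofLp)
        ((covOf ψ)⁻¹ * covOf v * (covOf ψ)⁻¹) (x - meanOf ψ).ofLp := by
  set S := covOf ψ with hS
  have hsymm : S.IsSymm := isSymm_covOf ψ
  have hM : ∀ i j, DifferentiableAt ℝ (fun t : ℝ => (S + t • covOf v) i j) 0 := fun i j => by
    simp only [Matrix.add_apply, Matrix.smul_apply]; fun_prop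
  have hpos : ∀ᶠ t : ℝ in 𝓝 0, 0 < (S + t • covOf v).det :=
    (differentiableAt_det hM).continuousAt.eventually (lt_mem_nhds (by simpa using hψ))
  have hder := (((hasDerivAt_log_det hψ.ne' (covOf v)).const_add
    (Real.log ((2 * Real.pi) ^ p))).add (hasDerivAt_quadraticForm_inv hψ.ne' hsymm (covOf v)
      (x - meanOf ψ).ofLp (meanOf v).ofLp)).const_mul (-(1 / 2))
  have heq : (fun t : ℝ => logDensity (ψ + t • v) x) =ᶠ[𝓝 0] fun t =>
      -(1 / 2) * ((Real.log ((2 * Real.pi) ^ p) + Real.log (S + t • covOf v).det) +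
        ((x - meanOf ψ).ofLp - t • (meanOf v).ofLp) ⬝ᵥ
          ((S + t • covOf v)⁻¹ *ᵥ ((x - meanOf ψ).ofLp - t • (meanOf v).ofLp))) := by
    filter_upwards [hpos] with t ht
    have hx : (x - meanOf (ψ + t • v)).ofLp = (x - meanOf ψ).ofLp - t • (meanOf v).ofLp := by
      rw [meanOf_add_smul, ← sub_sub]; rfl
    rw [logDensity, covOf_add_smul, log_gaussianDensity ht, hx]
  have := (hder.congr_of_eventuallyEq heq).deriv
  rw [lineDeriv, this, quadScore]
  have hST : (S⁻¹)ᵀ = S⁻¹ := by rw [Matrix.transpose_nonsing_inv, hsymm.eq]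
  rw [Matrix.nonsing_inv_mul_cancel_right _ _ (isUnit_iff_ne_zero.mpr hψ.ne'),
    Matrix.dotProduct_mulVec (meanOf v).ofLp, ← Matrix.mulVec_transpose, hST]
  ring

theorem meanPartial_eq (ψ : EuclideanSpace ℝ (ParamIndex p)) (i : ParamIndex p) :
    meanPartial ψ i = (meanOf (EuclideanSpace.single i (1 : ℝ))).ofLp := by
  funext a
  simp only [meanPartial, partialDeriv, lineDeriv, meanOf_add_smul]
  simp

theorem covPartial_eq (ψ : EuclideanSpace ℝ (ParamIndex p)) (i : ParamIndex p) :
    covPartial ψ i = covOf (EuclideanSpace.single i (1 : ℝ)) := by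
  ext a b
  simp only [covPartial, partialDeriv, lineDeriv, covOf_add_smul, Matrix.of_apply]
  simp

end GaussianML

/-! ### Gaussian moments up to order four. -/

namespace GaussianML

open scoped NNReal in
-- Moments are derivatives at `0` of the moment generating function `exp (v t² / 2)`.
theorem integral_pow_gaussianReal (v : ℝ≥0) :
    ∫ x, x ^ 3 ∂(gaussianReal 0 v) = 0 ∧ ∫ x, x ^ 4 ∂(gaussianReal 0 v) = 3 * (v : ℝ) ^ 2 := by
  have h0 : (0 : ℝ) ∈ interior (integrableExpSet id (gaussianReal 0 v)) := by
    simp [integrableExpSet_id_gaussianReal]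
  set e : ℝ → ℝ := fun t => Real.exp (v * t ^ 2 / 2) with he
  have hmgf : mgf id (gaussianReal 0 v) = e := by
    rw [mgf_id_gaussianReal]; funext t; simp [he]
  have hde : ∀ t, HasDerivAt e (v * t * e t) t := fun t => by
    have := ((((hasDerivAt_id t).pow 2).const_mul (v : ℝ)).div_const 2).exp
    convert! this using 1
    simp [he]; ring
  have hpow : ∀ (k : ℕ) (t : ℝ), HasDerivAt (fun t : ℝ => t ^ k) (k * t ^ (k - 1)) t :=
    fun k t => hasDerivAt_pow k t
  have d1 : deriv e = fun t => v * t * e t := funext fun t => (hde t).deriv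
  have d2 : deriv (fun t => v * t * e t) = fun t => (v + v ^ 2 * t ^ 2) * e t := funext fun t => by
    have := ((hasDerivAt_id t).const_mul (v : ℝ)).mul (hde t)
    refine (this.congr_deriv ?_).deriv
    simp; ring
  have d3 : deriv (fun t => (v + v ^ 2 * t ^ 2) * e t) =
      fun t => (3 * v ^ 2 * t + v ^ 3 * t ^ 3) * e t := funext fun t => by
    have := (((hpow 2 t).const_mul ((v : ℝ) ^ 2)).const_add (v : ℝ)).mul (hde t)
    refine (this.congr_deriv ?_).deriv
    simp; ring
  have d4 : deriv (fun t => (3 * v ^ 2 * t + v ^ 3 * t ^ 3) * e t) =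
      fun t => (3 * v ^ 2 + 6 * v ^ 3 * t ^ 2 + v ^ 4 * t ^ 4) * e t := funext fun t => by
    have := (((hasDerivAt_id t).const_mul (3 * (v : ℝ) ^ 2)).add
      ((hpow 3 t).const_mul ((v : ℝ) ^ 3))).mul (hde t)
    refine (this.congr_deriv ?_).deriv
    simp; ring
  have m3 := iteratedDeriv_mgf_zero h0 3
  have m4 := iteratedDeriv_mgf_zero h0 4
  simp only [hmgf, iteratedDeriv_succ, iteratedDeriv_zero, d1, d2, d3, d4] at m3 m4
  simp [he] at m3 m4
  exact ⟨m3.symm, m4.symm⟩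

variable {p : ℕ} (μ : EuclideanSpace ℝ (Fin p)) {S : Matrix (Fin p) (Fin p) ℝ}

/-- Reduces moments of linear forms to one-dimensional ones; mixed moments then follow by
polarization. -/
theorem hasLaw_dotProduct_sub (hS : S.PosSemidef) (u : Fin p → ℝ) :
    HasLaw (fun x : EuclideanSpace ℝ (Fin p) => u ⬝ᵥ (x - μ).ofLp)
      (gaussianReal 0 (u ⬝ᵥ (S *ᵥ u)).toNNReal) (multivariateGaussian μ S) := by
  set L : StrongDual ℝ (EuclideanSpace ℝ (Fin p)) := innerSL ℝ (WithLp.toLp 2 u) with hL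
  have happ : ∀ x : EuclideanSpace ℝ (Fin p), L x = u ⬝ᵥ x.ofLp := fun x => by
    simp [hL, PiLp.inner_apply, dotProduct, mul_comm]
  have hmean : ∫ x, L x ∂(multivariateGaussian μ S) = L μ := by
    rw [IsGaussian.integral_dual]; simp
  have hvar : Var[L; multivariateGaussian μ S] = u ⬝ᵥ (S *ᵥ u) := by
    have h := covarianceBilin_multivariateGaussian (μ := μ) hS (WithLp.toLp 2 u) (WithLp.toLp 2 u)
    rw [covarianceBilin_apply_eq_cov IsGaussian.memLp_two_id, covariance_self (by fun_prop)] at h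
    exact h
  have hlaw : HasLaw L (gaussianReal (L μ) (u ⬝ᵥ (S *ᵥ u)).toNNReal) (multivariateGaussian μ S) :=
    ⟨by fun_prop, by rw [IsGaussian.map_eq_gaussianReal, hmean, hvar]⟩
  have := gaussianReal_sub_const hlaw (L μ)
  rw [sub_self] at this
  convert! this using 2 with x
  rw [← map_sub, happ]

theorem integrable_dotProduct_pow (hS : S.PosSemidef) (u : Fin p → ℝ) (k : ℕ) :
    Integrable (fun x : EuclideanSpace ℝ (Fin p) => (u ⬝ᵥ (x - μ).ofLp) ^ k)
      (multivariateGaussian μ S) := by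
  have hlaw := hasLaw_dotProduct_sub μ hS u
  have h : Integrable (fun t : ℝ => t ^ k) (gaussianReal 0 (u ⬝ᵥ (S *ᵥ u)).toNNReal) := by
    have := (memLp_id_gaussianReal' (μ := 0) (v := (u ⬝ᵥ (S *ᵥ u)).toNNReal) (k : ENNReal)
      (by simp)).integrable_norm_pow'
    refine (integrable_norm_iff (by fun_prop)).mp ?_
    simpa [norm_pow] using this
  rw [← hlaw.map_eq] at h
  exact h.comp_aemeasurable hlaw.aemeasurable

theorem integral_dotProduct_pow (hS : S.PosSemidef) (u : Fin p → ℝ) (k : ℕ) :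
    ∫ x, (u ⬝ᵥ (x - μ).ofLp) ^ k ∂(multivariateGaussian μ S) =
      ∫ t, t ^ k ∂(gaussianReal 0 (u ⬝ᵥ (S *ᵥ u)).toNNReal) :=
  (hasLaw_dotProduct_sub μ hS u).integral_comp (f := fun t => t ^ k)
    (by fun_prop)

theorem integral_dotProduct_pow_four (hS : S.PosSemidef) (u : Fin p → ℝ) :
    ∫ x, (u ⬝ᵥ (x - μ).ofLp) ^ 4 ∂(multivariateGaussian μ S) = 3 * (u ⬝ᵥ (S *ᵥ u)) ^ 2 := by
  have hnn : 0 ≤ u ⬝ᵥ (S *ᵥ u) := by simpa using hS.dotProduct_mulVec_nonneg u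
  rw [integral_dotProduct_pow μ hS, (integral_pow_gaussianReal _).2, Real.coe_toNNReal _ hnn]

theorem integral_dotProduct_pow_three (hS : S.PosSemidef) (u : Fin p → ℝ) :
    ∫ x, (u ⬝ᵥ (x - μ).ofLp) ^ 3 ∂(multivariateGaussian μ S) = 0 := by
  rw [integral_dotProduct_pow μ hS, (integral_pow_gaussianReal _).1]

theorem integral_dotProduct_pow_two (hS : S.PosSemidef) (u : Fin p → ℝ) :
    ∫ x, (u ⬝ᵥ (x - μ).ofLp) ^ 2 ∂(multivariateGaussian μ S) = u ⬝ᵥ (S *ᵥ u) := by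
  have hnn : 0 ≤ u ⬝ᵥ (S *ᵥ u) := by simpa using hS.dotProduct_mulVec_nonneg u
  rw [integral_dotProduct_pow μ hS]
  have := variance_eq_integral (μ := gaussianReal 0 (u ⬝ᵥ (S *ᵥ u)).toNNReal)
    (X := fun x => x) (by fun_prop)
  rw [variance_fun_id_gaussianReal, integral_id_gaussianReal, Real.coe_toNNReal _ hnn] at this
  simpa using this.symm

theorem integral_dotProduct (hS : S.PosSemidef) (u : Fin p → ℝ) :
    ∫ x, u ⬝ᵥ (x - μ).ofLp ∂(multivariateGaussian μ S) = 0 := by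
  have := integral_dotProduct_pow μ hS u 1
  simpa [integral_id_gaussianReal] using this

theorem _root_.Matrix.IsSymm.dotProduct_mulVec_comm {n : Type*} [Fintype n] {S : Matrix n n ℝ}
    (hS : S.IsSymm) (u v : n → ℝ) : u ⬝ᵥ (S *ᵥ v) = v ⬝ᵥ (S *ᵥ u) := by
  rw [Matrix.dotProduct_mulVec, ← Matrix.mulVec_transpose, hS.eq, dotProduct_comm]

theorem _root_.Matrix.PosSemidef.isSymm {n : Type*} {S : Matrix n n ℝ}
    (hS : S.PosSemidef) : S.IsSymm := by
  have := hS.1.eq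
  rwa [Matrix.conjTranspose_eq_transpose_of_trivial] at this

/-- **Isserlis' theorem** for four linear forms. -/
theorem isserlis_four (hS : S.PosSemidef) (u v w z : Fin p → ℝ) :
    Integrable (fun x : EuclideanSpace ℝ (Fin p) => (u ⬝ᵥ (x - μ).ofLp) * (v ⬝ᵥ (x - μ).ofLp) *
      ((w ⬝ᵥ (x - μ).ofLp) * (z ⬝ᵥ (x - μ).ofLp))) (multivariateGaussian μ S) ∧
    ∫ x, (u ⬝ᵥ (x - μ).ofLp) * (v ⬝ᵥ (x - μ).ofLp) *
      ((w ⬝ᵥ (x - μ).ofLp) * (z ⬝ᵥ (x - μ).ofLp)) ∂(multivariateGaussian μ S) =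
      (u ⬝ᵥ (S *ᵥ v)) * (w ⬝ᵥ (S *ᵥ z)) + (u ⬝ᵥ (S *ᵥ w)) * (v ⬝ᵥ (S *ᵥ z)) +
        (u ⬝ᵥ (S *ᵥ z)) * (v ⬝ᵥ (S *ᵥ w)) := by
  have hint := fun r => integrable_dotProduct_pow μ hS r 4
  have hsum : ∀ r s, Integrable (fun x : EuclideanSpace ℝ (Fin p) => (r ⬝ᵥ (x - μ).ofLp) ^ 4 +
      (s ⬝ᵥ (x - μ).ofLp) ^ 4) (multivariateGaussian μ S) := fun r s => (hint r).add (hint s)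
  have hval := integral_dotProduct_pow_four μ hS
  have hsum2 : ∀ r s q t, Integrable (fun x : EuclideanSpace ℝ (Fin p) =>
      (r ⬝ᵥ (x - μ).ofLp) ^ 4 + (s ⬝ᵥ (x - μ).ofLp) ^ 4 +
        ((q ⬝ᵥ (x - μ).ofLp) ^ 4 + (t ⬝ᵥ (x - μ).ofLp) ^ 4)) (multivariateGaussian μ S) :=
    fun r s q t => (hsum r s).add (hsum q t)
  -- Polarization of fourth powers: the eight sign patterns with `u` kept positive, each weighted by
  -- the product of its signs, yield `8 * 4! = 192` times the product.
  have heq : (fun x : EuclideanSpace ℝ (Fin p) => (u ⬝ᵥ (x - μ).ofLp) * (v ⬝ᵥ (x - μ).ofLp) *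
      ((w ⬝ᵥ (x - μ).ofLp) * (z ⬝ᵥ (x - μ).ofLp))) = fun x =>
      1 / 192 * (((((u + v + w + z) ⬝ᵥ (x - μ).ofLp) ^ 4 + ((u + v - w - z) ⬝ᵥ (x - μ).ofLp) ^ 4) +
        (((u - v + w - z) ⬝ᵥ (x - μ).ofLp) ^ 4 + ((u - v - w + z) ⬝ᵥ (x - μ).ofLp) ^ 4)) -
        ((((u + v + w - z) ⬝ᵥ (x - μ).ofLp) ^ 4 + ((u + v - w + z) ⬝ᵥ (x - μ).ofLp) ^ 4) +
        (((u - v + w + z) ⬝ᵥ (x - μ).ofLp) ^ 4 + ((u - v - w - z) ⬝ᵥ (x - μ).ofLp) ^ 4))) := by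
    funext x
    simp only [add_dotProduct, sub_dotProduct]
    ring
  have hisum : ∀ r s, ∫ x, ((r ⬝ᵥ (x - μ).ofLp) ^ 4 + (s ⬝ᵥ (x - μ).ofLp) ^ 4)
      ∂(multivariateGaussian μ S) = 3 * (r ⬝ᵥ (S *ᵥ r)) ^ 2 + 3 * (s ⬝ᵥ (S *ᵥ s)) ^ 2 :=
      fun r s => by
    rw [integral_add (hint r) (hint s), hval, hval]
  rw [heq]
  refine ⟨((hsum2 _ _ _ _).sub (hsum2 _ _ _ _)).const_mul _, ?_⟩
  rw [integral_const_mul, integral_sub (hsum2 _ _ _ _) (hsum2 _ _ _ _),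
    integral_add (hsum _ _) (hsum _ _), integral_add (hsum _ _) (hsum _ _)]
  simp only [hisum]
  have hsymm := hS.isSymm
  simp only [Matrix.mulVec_add, Matrix.mulVec_sub, dotProduct_add, dotProduct_sub, add_dotProduct,
    sub_dotProduct, hsymm.dotProduct_mulVec_comm v u, hsymm.dotProduct_mulVec_comm w u,
    hsymm.dotProduct_mulVec_comm z u, hsymm.dotProduct_mulVec_comm w v,
    hsymm.dotProduct_mulVec_comm z v, hsymm.dotProduct_mulVec_comm z w]
  ring

/-- Polarization of cubes, with `24 = 4 * 3!`; every cube of a centered linear form has mean zero.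
-/
theorem isserlis_three (hS : S.PosSemidef) (u v w : Fin p → ℝ) :
    Integrable (fun x : EuclideanSpace ℝ (Fin p) => (u ⬝ᵥ (x - μ).ofLp) *
      ((v ⬝ᵥ (x - μ).ofLp) * (w ⬝ᵥ (x - μ).ofLp))) (multivariateGaussian μ S) ∧
    ∫ x, (u ⬝ᵥ (x - μ).ofLp) * ((v ⬝ᵥ (x - μ).ofLp) * (w ⬝ᵥ (x - μ).ofLp))
      ∂(multivariateGaussian μ S) = 0 := by
  have hint := fun r => integrable_dotProduct_pow μ hS r 3
  have hsum : ∀ r s, Integrable (fun x : EuclideanSpace ℝ (Fin p) => (r ⬝ᵥ (x - μ).ofLp) ^ 3 +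
      (s ⬝ᵥ (x - μ).ofLp) ^ 3) (multivariateGaussian μ S) := fun r s => (hint r).add (hint s)
  have hval := integral_dotProduct_pow_three μ hS
  have heq : (fun x : EuclideanSpace ℝ (Fin p) => (u ⬝ᵥ (x - μ).ofLp) *
      ((v ⬝ᵥ (x - μ).ofLp) * (w ⬝ᵥ (x - μ).ofLp))) = fun x =>
      1 / 24 * ((((u + v + w) ⬝ᵥ (x - μ).ofLp) ^ 3 + ((u - v - w) ⬝ᵥ (x - μ).ofLp) ^ 3) -
        (((u + v - w) ⬝ᵥ (x - μ).ofLp) ^ 3 + ((u - v + w) ⬝ᵥ (x - μ).ofLp) ^ 3)) := by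
    funext x
    simp only [add_dotProduct, sub_dotProduct]
    ring
  rw [heq]
  refine ⟨((hsum _ _).sub (hsum _ _)).const_mul _, ?_⟩
  rw [integral_const_mul, integral_sub (hsum _ _) (hsum _ _), integral_add (hint _) (hint _),
    integral_add (hint _) (hint _)]
  simp only [hval]
  ring

theorem isserlis_two (hS : S.PosSemidef) (u v : Fin p → ℝ) :
    Integrable (fun x : EuclideanSpace ℝ (Fin p) =>
      (u ⬝ᵥ (x - μ).ofLp) * (v ⬝ᵥ (x - μ).ofLp)) (multivariateGaussian μ S) ∧
    ∫ x, (u ⬝ᵥ (x - μ).ofLp) * (v ⬝ᵥ (x - μ).ofLp) ∂(multivariateGaussian μ S) =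
      u ⬝ᵥ (S *ᵥ v) := by
  have hint := fun r => integrable_dotProduct_pow μ hS r 2
  have heq : (fun x : EuclideanSpace ℝ (Fin p) => (u ⬝ᵥ (x - μ).ofLp) * (v ⬝ᵥ (x - μ).ofLp)) =
      fun x => 1 / 4 * (((u + v) ⬝ᵥ (x - μ).ofLp) ^ 2 - ((u - v) ⬝ᵥ (x - μ).ofLp) ^ 2) := by
    funext x
    simp only [add_dotProduct, sub_dotProduct]
    ring
  rw [heq]
  refine ⟨((hint _).sub (hint _)).const_mul _, ?_⟩
  rw [integral_const_mul, integral_sub (hint _) (hint _)]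
  rw [integral_dotProduct_pow_two μ hS, integral_dotProduct_pow_two μ hS]
  simp only [Matrix.mulVec_add, Matrix.mulVec_sub,
    dotProduct_add, dotProduct_sub, add_dotProduct, sub_dotProduct,
    hS.isSymm.dotProduct_mulVec_comm v u]
  ring

theorem measurable_dotProduct_sub (u : Fin p → ℝ) :
    Measurable (fun x : EuclideanSpace ℝ (Fin p) => u ⬝ᵥ (x - μ).ofLp) := by
  simp only [dotProduct, WithLp.ofLp_sub, Pi.sub_apply]
  fun_prop

theorem memLp_dotProduct (hS : S.PosSemidef) (u : Fin p → ℝ) :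
    MemLp (fun x : EuclideanSpace ℝ (Fin p) => u ⬝ᵥ (x - μ).ofLp) 2 (multivariateGaussian μ S) :=
  (memLp_two_iff_integrable_sq (measurable_dotProduct_sub μ u).aestronglyMeasurable).mpr
    (integrable_dotProduct_pow μ hS u 2)

theorem memLp_dotProduct_mul (hS : S.PosSemidef) (u v : Fin p → ℝ) :
    MemLp (fun x : EuclideanSpace ℝ (Fin p) => (u ⬝ᵥ (x - μ).ofLp) * (v ⬝ᵥ (x - μ).ofLp)) 2
      (multivariateGaussian μ S) := by
  refine (memLp_two_iff_integrable_sq ((measurable_dotProduct_sub μ u).fun_mul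
    (measurable_dotProduct_sub μ v)).aestronglyMeasurable).mpr ?_
  simpa only [sq] using (isserlis_four μ hS u v u v).1

/-- A sum of products of two linear forms is the shape to which the Isserlis formulas apply. -/
theorem dotProduct_mulVec_eq_sum (M : Matrix (Fin p) (Fin p) ℝ) (y : Fin p → ℝ) :
    y ⬝ᵥ (M *ᵥ y) = ∑ a, ((Pi.single a 1 : Fin p → ℝ) ⬝ᵥ y) * (M.row a ⬝ᵥ y) := by
  simp_rw [single_one_dotProduct]; rfl

theorem memLp_quadraticForm (hS : S.PosSemidef) (M : Matrix (Fin p) (Fin p) ℝ) :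
    MemLp (fun x : EuclideanSpace ℝ (Fin p) => (x - μ).ofLp ⬝ᵥ (M *ᵥ (x - μ).ofLp)) 2
      (multivariateGaussian μ S) := by
  simp_rw [dotProduct_mulVec_eq_sum]
  exact memLp_finsetSum _ fun a _ => memLp_dotProduct_mul μ hS _ _

theorem integral_quadraticForm (hS : S.PosSemidef) (M : Matrix (Fin p) (Fin p) ℝ) :
    ∫ x, (x - μ).ofLp ⬝ᵥ (M *ᵥ (x - μ).ofLp) ∂(multivariateGaussian μ S) = (M * S).trace := by
  simp_rw [dotProduct_mulVec_eq_sum]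
  rw [integral_finsetSum _ fun a _ => (isserlis_two μ hS _ _).1]
  simp_rw [(isserlis_two μ hS _ _).2, Matrix.trace, Matrix.diag, Matrix.mul_apply]
  refine Finset.sum_congr rfl fun a _ => ?_
  rw [hS.isSymm.dotProduct_mulVec_comm]
  simp [dotProduct]

theorem integral_dotProduct_mul_quadraticForm (hS : S.PosSemidef) (b : Fin p → ℝ)
    (M : Matrix (Fin p) (Fin p) ℝ) :
    ∫ x, (b ⬝ᵥ (x - μ).ofLp) * ((x - μ).ofLp ⬝ᵥ (M *ᵥ (x - μ).ofLp))
      ∂(multivariateGaussian μ S) = 0 := by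
  simp_rw [dotProduct_mulVec_eq_sum, Finset.mul_sum]
  rw [integral_finsetSum _ fun a _ => (isserlis_three μ hS _ _ _).1]
  simp_rw [(isserlis_three μ hS _ _ _).2]
  simp

/-- Of the three Isserlis pairings, one gives the product of traces. The other two give traces with
`M'` and `M'ᵀ`, which coincide by symmetry. -/
theorem integral_quadraticForm_mul_quadraticForm (hS : S.PosSemidef)
    {M M' : Matrix (Fin p) (Fin p) ℝ} (hM' : M'.IsSymm) :
    ∫ x, ((x - μ).ofLp ⬝ᵥ (M *ᵥ (x - μ).ofLp)) * ((x - μ).ofLp ⬝ᵥ (M' *ᵥ (x - μ).ofLp))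
      ∂(multivariateGaussian μ S) =
      (M * S).trace * (M' * S).trace + 2 * (M * S * M' * S).trace := by
  simp_rw [dotProduct_mulVec_eq_sum, Finset.sum_mul_sum]
  rw [integral_finsetSum _ fun a _ => integrable_finsetSum _ fun c _ =>
    (isserlis_four μ hS _ _ _ _).1]
  simp_rw [integral_finsetSum Finset.univ fun c _ => (isserlis_four μ hS _ _ _ _).1,
    (isserlis_four μ hS _ _ _ _).2]
  have hsymm := hS.isSymm
  have e1 : ∀ (N : Matrix (Fin p) (Fin p) ℝ) a c,
      (Pi.single a 1 : Fin p → ℝ) ⬝ᵥ (S *ᵥ N.row c) = (N * S) c a := fun N a c => by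
    rw [hsymm.dotProduct_mulVec_comm]; simp [Matrix.mul_apply, dotProduct]
  have e2 : ∀ a c, (Pi.single a 1 : Fin p → ℝ) ⬝ᵥ (S *ᵥ Pi.single c 1) = S a c := fun a c => by
    simp
  have e3 : ∀ (N : Matrix (Fin p) (Fin p) ℝ) a c,
      N.row a ⬝ᵥ (S *ᵥ Pi.single c 1) = (N * S) a c := fun N a c => by
    simp [Matrix.mul_apply, dotProduct]
  have e4 : ∀ a c, M.row a ⬝ᵥ (S *ᵥ M'.row c) = (M * S * M'ᵀ) a c := fun a c => by
    rw [Matrix.mul_assoc, Matrix.mul_apply]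
    simp [dotProduct, Matrix.mulVec, Matrix.mul_apply, Matrix.transpose_apply]
  simp_rw [e1, e2, e3, e4, Finset.sum_add_distrib]
  have t1 : ∑ a, ∑ c, (M * S) a a * (M' * S) c c = (M * S).trace * (M' * S).trace := by
    simp [Matrix.trace, Finset.sum_mul_sum]
  have t2 : ∑ a, ∑ c, S a c * (M * S * M'ᵀ) a c = (M * S * M' * S).trace := by
    rw [hM'.eq, Matrix.trace]
    refine Finset.sum_congr rfl fun a _ => ?_
    rw [Matrix.diag_apply, Matrix.mul_apply]
    refine Finset.sum_congr rfl fun c _ => ?_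
    rw [mul_comm, hsymm.apply]
  have t3 : ∑ a, ∑ c, (M' * S) c a * (M * S) a c = (M * S * M' * S).trace := by
    rw [Matrix.mul_assoc (M * S), Matrix.trace]
    refine Finset.sum_congr rfl fun a _ => ?_
    rw [Matrix.diag_apply, Matrix.mul_apply]
    exact Finset.sum_congr rfl fun c _ => mul_comm _ _
  rw [t1, t2, t3]
  ring

theorem memLp_quadScore (hS : S.PosSemidef) (b : Fin p → ℝ) (M : Matrix (Fin p) (Fin p) ℝ) :
    MemLp (fun x : EuclideanSpace ℝ (Fin p) => quadScore S b M (x - μ).ofLp) 2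
      (multivariateGaussian μ S) :=
  (memLp_dotProduct μ hS b).add (((memLp_quadraticForm μ hS M).sub (memLp_const _)).const_mul _)

theorem integral_quadScore (hS : S.PosSemidef) (b : Fin p → ℝ) (M : Matrix (Fin p) (Fin p) ℝ) :
    ∫ x, quadScore S b M (x - μ).ofLp ∂(multivariateGaussian μ S) = 0 := by
  have h1 := (memLp_dotProduct μ hS b).integrable one_le_two
  have h2 := (memLp_quadraticForm μ hS M).integrable one_le_two
  have h3 : Integrable (fun x : EuclideanSpace ℝ (Fin p) =>
      1 / 2 * ((x - μ).ofLp ⬝ᵥ (M *ᵥ (x - μ).ofLp) - (M * S).trace)) (multivariateGaussian μ S) :=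
    (h2.sub (integrable_const _)).const_mul _
  unfold quadScore
  rw [integral_add h1 h3, integral_const_mul, integral_sub h2 (integrable_const _),
    integral_dotProduct μ hS, integral_quadraticForm μ hS]
  simp

/-- Linear and quadratic parts are uncorrelated because third moments vanish. The factor `1 / 2` is
`2 * (1 / 2) ^ 2`. -/
theorem covariance_quadScore (hS : S.PosSemidef) (b b' : Fin p → ℝ)
    {M M' : Matrix (Fin p) (Fin p) ℝ} (hM' : M'.IsSymm) :
    cov[fun x : EuclideanSpace ℝ (Fin p) => quadScore S b M (x - μ).ofLp,
      fun x => quadScore S b' M' (x - μ).ofLp; multivariateGaussian μ S] =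
      b ⬝ᵥ (S *ᵥ b') + 1 / 2 * (M * S * M' * S).trace := by
  set ν := multivariateGaussian μ S
  have hA := memLp_dotProduct μ hS
  have hB := memLp_quadraticForm μ hS
  have hAA : ∀ u v, cov[fun x : EuclideanSpace ℝ (Fin p) => u ⬝ᵥ (x - μ).ofLp,
      fun x => v ⬝ᵥ (x - μ).ofLp; ν] = u ⬝ᵥ (S *ᵥ v) := fun u v => by
    rw [covariance_eq_sub (hA u) (hA v), integral_dotProduct μ hS]
    simpa using (isserlis_two μ hS u v).2
  have hAB : ∀ u N, cov[fun x : EuclideanSpace ℝ (Fin p) => u ⬝ᵥ (x - μ).ofLp,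
      fun x => (x - μ).ofLp ⬝ᵥ (N *ᵥ (x - μ).ofLp); ν] = 0 := fun u N => by
    rw [covariance_eq_sub (hA u) (hB N), integral_dotProduct μ hS]
    simpa using integral_dotProduct_mul_quadraticForm μ hS u N
  have hBB : cov[fun x : EuclideanSpace ℝ (Fin p) => (x - μ).ofLp ⬝ᵥ (M *ᵥ (x - μ).ofLp),
      fun x => (x - μ).ofLp ⬝ᵥ (M' *ᵥ (x - μ).ofLp); ν] = 2 * (M * S * M' * S).trace := by
    rw [covariance_eq_sub (hB M) (hB M'), integral_quadraticForm μ hS,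
      integral_quadraticForm μ hS]
    have := integral_quadraticForm_mul_quadraticForm μ hS (M := M) hM'
    simp only [Pi.mul_apply]
    rw [this]; ring
  have hq : ∀ u N, (fun x : EuclideanSpace ℝ (Fin p) => quadScore S u N (x - μ).ofLp) = fun x =>
      ((fun x : EuclideanSpace ℝ (Fin p) => u ⬝ᵥ (x - μ).ofLp) + (1 / 2 : ℝ) •
        fun x : EuclideanSpace ℝ (Fin p) => (x - μ).ofLp ⬝ᵥ (N *ᵥ (x - μ).ofLp)) x +
        -(1 / 2 * (N * S).trace) := fun u N => by
    funext x
    simp only [quadScore, Pi.add_apply, Pi.smul_apply, smul_eq_mul]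
    ring
  have hB' := fun N => (hB N).const_smul (1 / 2 : ℝ)
  rw [hq, hq, covariance_add_const_left (((hA b).add (hB' M)).integrable one_le_two),
    covariance_add_const_right (((hA b').add (hB' M')).integrable one_le_two),
    covariance_add_left (hA b) (hB' M) ((hA b').add (hB' M')),
    covariance_add_right (hA b) (hA b') (hB' M'), covariance_add_right (hB' M) (hA b') (hB' M'),
    covariance_smul_right, covariance_smul_left, covariance_smul_left, covariance_smul_right,
    hAA, hAB, hBB, covariance_comm, hAB]
  ring

end GaussianML

/-! ### Vector central limit theorem, Fisher information and the centered statistic. -/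

namespace GaussianML

section VectorCLT

variable {ι : Type*} [Fintype ι] [DecidableEq ι] {Ω : Type*} [MeasurableSpace Ω] {P : Measure Ω}
  [IsProbabilityMeasure P]

/-- **Central limit theorem** for independent, identically distributed, centered random vectors. -/
theorem tendstoInDistribution_inv_sqrt_smul_sum {Y : ℕ → Ω → EuclideanSpace ℝ ι}
    (hindep : iIndepFun Y P) (hident : ∀ i, IdentDistrib (Y i) (Y 0) P P)
    {K : Matrix ι ι ℝ} (hK : K.PosSemidef)
    (hmem : ∀ t : EuclideanSpace ℝ ι, MemLp (fun w => inner ℝ t (Y 0 w)) 2 P)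
    (hmean : ∀ t : EuclideanSpace ℝ ι, ∫ w, inner ℝ t (Y 0 w) ∂P = 0)
    (hvar : ∀ t : EuclideanSpace ℝ ι,
      Var[fun w => inner ℝ t (Y 0 w); P] = t.ofLp ⬝ᵥ (K *ᵥ t.ofLp)) :
    TendstoInDistribution (fun (n : ℕ) w => (Real.sqrt n)⁻¹ • ∑ k ∈ Finset.range n, Y k w) atTop
      (fun z : EuclideanSpace ℝ ι => z) (fun _ => P) (multivariateGaussian 0 K) where
  forall_aemeasurable n :=
    (Finset.aemeasurable_fun_sum _ fun i _ => (hident i).aemeasurable_fst).fun_const_smul _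
  tendsto := by
    have haem : ∀ n : ℕ, AEMeasurable
        (fun w => (Real.sqrt n)⁻¹ • ∑ k ∈ Finset.range n, Y k w) P := fun n =>
      (Finset.aemeasurable_fun_sum _ fun i _ => (hident i).aemeasurable_fst).fun_const_smul _
    -- Cramér–Wold: the characteristic function at `t` is that of the scalar sums of `⟨t, Y k⟩` at
    -- frequency `1`, where the scalar theorem applies.
    refine ProbabilityMeasure.tendsto_iff_tendsto_charFun.2 fun t => ?_
    have hnn : 0 ≤ t.ofLp ⬝ᵥ (K *ᵥ t.ofLp) := by simpa using hK.dotProduct_mulVec_nonneg t.ofLp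
    have hclt := tendstoInDistribution_inv_sqrt_mul_sum_sub (P := P)
      (X := fun k w => inner ℝ t (Y k w))
      (Y := fun z : ℝ => z)
      (P' := gaussianReal 0 Var[fun w => inner ℝ t (Y 0 w); P].toNNReal) HasLaw.id (hmem t)
      (hindep.comp (fun _ y => inner ℝ t y) fun _ => by fun_prop)
      (fun i => (hident i).comp (u := fun y => inner ℝ t y) (by fun_prop))
    have hlim := ProbabilityMeasure.tendsto_iff_tendsto_charFun.1 hclt.tendsto 1
    have h1 : charFun ((multivariateGaussian 0 K).map fun z : EuclideanSpace ℝ ι => z) t =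
        charFun ((gaussianReal 0 Var[fun w => inner ℝ t (Y 0 w); P].toNNReal).map
          fun z : ℝ => z) 1 := by
      rw [Measure.map_id', Measure.map_id', charFun_multivariateGaussian hK, charFun_gaussianReal,
        hvar, Real.coe_toNNReal _ hnn]
      simp
    have h2 : ∀ n : ℕ, charFun (P.map fun w => (Real.sqrt n)⁻¹ • ∑ k ∈ Finset.range n, Y k w) t =
        charFun (P.map fun w => (Real.sqrt n)⁻¹ * (∑ k ∈ Finset.range n, inner ℝ t (Y k w) -
          n * ∫ w, inner ℝ t (Y 0 w) ∂P)) 1 := fun n => by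
      rw [charFun_apply, charFun_apply, integral_map (haem n) (by fun_prop),
        integral_map (hclt.forall_aemeasurable n) (by fun_prop)]
      congr 1
      funext w
      have h : inner ℝ ((Real.sqrt n)⁻¹ • ∑ k ∈ Finset.range n, Y k w) t =
          (Real.sqrt n)⁻¹ * ∑ k ∈ Finset.range n, inner ℝ t (Y k w) := by
        rw [real_inner_comm, real_inner_smul_right, inner_sum]
      rw [hmean, h]
      simp
    simp only [ProbabilityMeasure.coe_mk] at hlim ⊢
    rw [h1]
    simp_rw [h2]
    exact hlim

end VectorCLT

variable {p : ℕ}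

/-- The bilinear form of the Fisher information at a normal distribution with covariance `S`. -/
noncomputable def infoForm (S : Matrix (Fin p) (Fin p) ℝ) :
    EuclideanSpace ℝ (ParamIndex p) →ₗ[ℝ] EuclideanSpace ℝ (ParamIndex p) →ₗ[ℝ] ℝ :=
  LinearMap.mk₂ ℝ
    (fun v w => (meanLin p v).ofLp ⬝ᵥ (S⁻¹ *ᵥ (meanLin p w).ofLp) +
      1 / 2 * (S⁻¹ * covLin p v * S⁻¹ * covLin p w).trace)
    (fun _ _ _ => by
      simp only [map_add, WithLp.ofLp_add, add_dotProduct, mul_add, add_mul,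
        Matrix.trace_add]; ring)
    (fun _ _ _ => by
      simp only [map_smul, WithLp.ofLp_smul, smul_dotProduct, Matrix.mul_smul, Matrix.smul_mul,
        Matrix.trace_smul, smul_eq_mul]; ring)
    (fun _ _ _ => by
      simp only [map_add, WithLp.ofLp_add, Matrix.mulVec_add, dotProduct_add, mul_add,
        Matrix.trace_add]; ring)
    (fun _ _ _ => by
      simp only [map_smul, WithLp.ofLp_smul, Matrix.mulVec_smul, dotProduct_smul, Matrix.mul_smul,
        Matrix.trace_smul, smul_eq_mul]; ring)

theorem infoForm_apply (S : Matrix (Fin p) (Fin p) ℝ) (v w : EuclideanSpace ℝ (ParamIndex p)) :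
    infoForm S v w = (meanOf v).ofLp ⬝ᵥ (S⁻¹ *ᵥ (meanOf w).ofLp) +
      1 / 2 * (S⁻¹ * covOf v * S⁻¹ * covOf w).trace := rfl

/-- The matrix of `infoForm`. -/
noncomputable def infoMatrix (S : Matrix (Fin p) (Fin p) ℝ) :
    Matrix (ParamIndex p) (ParamIndex p) ℝ :=
  Matrix.of fun i j => infoForm S (EuclideanSpace.single i 1) (EuclideanSpace.single j 1)

theorem dotProduct_infoMatrix_mulVec (S : Matrix (Fin p) (Fin p) ℝ)
    (v w : EuclideanSpace ℝ (ParamIndex p)) :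
    v.ofLp ⬝ᵥ (infoMatrix S *ᵥ w.ofLp) = infoForm S v w := by
  have hsum : ∀ u : EuclideanSpace ℝ (ParamIndex p),
      u = ∑ i, u i • EuclideanSpace.single i (1 : ℝ) := fun u => by
    simpa using ((EuclideanSpace.basisFun (ParamIndex p) ℝ).sum_repr u).symm
  conv_rhs => rw [hsum v, hsum w]
  simp only [map_sum, map_smul, LinearMap.sum_apply, LinearMap.smul_apply, smul_eq_mul,
    dotProduct, Matrix.mulVec, infoMatrix, Matrix.of_apply, Finset.mul_sum]
  rw [Finset.sum_comm]
  exact Finset.sum_congr rfl fun i _ => Finset.sum_congr rfl fun j _ => by ring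

theorem infoForm_comm {S : Matrix (Fin p) (Fin p) ℝ} (hS : S.IsSymm)
    (v w : EuclideanSpace ℝ (ParamIndex p)) : infoForm S v w = infoForm S w v := by
  have hinv : (S⁻¹).IsSymm := by
    rw [Matrix.IsSymm, Matrix.transpose_nonsing_inv, hS.eq]
  rw [infoForm_apply, infoForm_apply, hinv.dotProduct_mulVec_comm, Matrix.mul_assoc (S⁻¹ * covOf v),
    Matrix.trace_mul_comm, Matrix.mul_assoc (S⁻¹ * covOf w)]

/-- With `S⁻¹ = Bᵀ B`, the trace term is half the squared Frobenius norm of `B (covOf v) Bᵀ`. Both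
terms are nonnegative, and they vanish together only if the mean and covariance parts of `v`, hence
`v`, are zero. -/
theorem infoForm_self_pos {S : Matrix (Fin p) (Fin p) ℝ} (hS : S.PosDef)
    {v : EuclideanSpace ℝ (ParamIndex p)} (hv : v ≠ 0) : 0 < infoForm S v v := by
  obtain ⟨B, hBu, hB⟩ := hS.inv.exists_transpose_mul_self
  have hBu' : IsUnit B := (Matrix.isUnit_iff_isUnit_det B).mpr hBu
  set N := B * covOf v * Bᵀ with hN
  have hNs : Nᵀ = N := by
    simp only [hN, Matrix.transpose_mul, Matrix.transpose_transpose, (isSymm_covOf v).eq,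
      Matrix.mul_assoc]
  have htr : (S⁻¹ * covOf v * S⁻¹ * covOf v).trace = (Nᴴ * N).trace := by
    rw [Matrix.conjTranspose_eq_transpose_of_trivial, hNs, hB, hN]
    have : Bᵀ * B * covOf v * (Bᵀ * B) * covOf v = Bᵀ * (B * covOf v * Bᵀ * (B * covOf v)) := by
      simp only [Matrix.mul_assoc]
    rw [this, Matrix.trace_mul_comm]
    simp only [Matrix.mul_assoc]
  have hpsd := Matrix.posSemidef_conjTranspose_mul_self N
  have htr0 : 0 ≤ (Nᴴ * N).trace := hpsd.trace_nonneg
  have hq0 : 0 ≤ (meanOf v).ofLp ⬝ᵥ (S⁻¹ *ᵥ (meanOf v).ofLp) := by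
    simpa using hS.inv.posSemidef.dotProduct_mulVec_nonneg (meanOf v).ofLp
  rw [infoForm_apply, htr]
  by_cases hm : (meanOf v).ofLp = 0
  · have hc : covOf v ≠ 0 := fun hc => hv <| by
      rw [← paramVec_meanOf_covOf v, hc]
      ext k
      rcases k with a | a
      · exact congrFun hm a
      · rfl
    have hne : (Nᴴ * N).trace ≠ 0 := fun h0 => hc <| by
      rw [hpsd.trace_eq_zero_iff, Matrix.conjTranspose_mul_self_eq_zero] at h0
      have h1 := (((Matrix.isUnit_transpose B).mpr hBu').mul_left_eq_zero).mp h0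
      exact (hBu'.mul_right_eq_zero).mp h1
    have := lt_of_le_of_ne htr0 hne.symm
    linarith
  · have := hS.inv.dotProduct_mulVec_pos hm
    simp only [star_trivial] at this
    linarith

theorem posDef_infoMatrix {S : Matrix (Fin p) (Fin p) ℝ} (hS : S.PosDef) :
    (infoMatrix S).PosDef := by
  refine Matrix.PosDef.of_dotProduct_mulVec_pos ?_ fun x hx => ?_
  · ext i j
    exact infoForm_comm hS.posSemidef.isSymm _ _
  · have := dotProduct_infoMatrix_mulVec S (WithLp.toLp 2 x) (WithLp.toLp 2 x)
    simp only [star_trivial] at this ⊢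
    rw [this]
    exact infoForm_self_pos hS fun h => hx (by simpa using congrArg WithLp.ofLp h)

/-- The score in direction `v` is a polynomial of degree two in the centered observation. -/
noncomputable def dirScore (S : Matrix (Fin p) (Fin p) ℝ) (v : EuclideanSpace ℝ (ParamIndex p)) :
    (Fin p → ℝ) → ℝ :=
  quadScore S (S⁻¹ *ᵥ (meanOf v).ofLp) (S⁻¹ * covOf v * S⁻¹)

theorem isSymm_inv_mul_covOf_mul_inv {S : Matrix (Fin p) (Fin p) ℝ} (hS : S.IsSymm)
    (v : EuclideanSpace ℝ (ParamIndex p)) : (S⁻¹ * covOf v * S⁻¹).IsSymm := by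
  rw [Matrix.IsSymm, Matrix.transpose_mul, Matrix.transpose_mul, Matrix.transpose_nonsing_inv,
    hS.eq, (isSymm_covOf v).eq, Matrix.mul_assoc]

theorem covariance_dirScore (μ : EuclideanSpace ℝ (Fin p)) {S : Matrix (Fin p) (Fin p) ℝ}
    (hS : S.PosDef) (v w : EuclideanSpace ℝ (ParamIndex p)) :
    cov[fun x : EuclideanSpace ℝ (Fin p) => dirScore S v (x - μ).ofLp,
      fun x => dirScore S w (x - μ).ofLp; multivariateGaussian μ S] = infoForm S v w := by
  have hu : IsUnit S.det := isUnit_iff_ne_zero.mpr hS.det_pos.ne'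
  have hsymm := hS.posSemidef.isSymm
  have hinv : (S⁻¹).IsSymm := by rw [Matrix.IsSymm, Matrix.transpose_nonsing_inv, hsymm.eq]
  unfold dirScore
  rw [covariance_quadScore μ hS.posSemidef _ _ (isSymm_inv_mul_covOf_mul_inv hsymm w),
    infoForm_apply, Matrix.mulVec_mulVec, Matrix.mul_nonsing_inv _ hu, Matrix.one_mulVec,
    dotProduct_comm, hinv.dotProduct_mulVec_comm]
  congr 2
  rw [Matrix.nonsing_inv_mul_cancel_right _ _ hu, Matrix.mul_assoc (S⁻¹ * covOf v),
    Matrix.nonsing_inv_mul_cancel_right _ _ hu, Matrix.mul_assoc (S⁻¹ * covOf v)]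

/-- The centered sufficient statistic `(x - μ, vech ((x - μ)(x - μ)ᵀ - S))`. -/
noncomputable def centeredStat (μ : EuclideanSpace ℝ (Fin p)) (S : Matrix (Fin p) (Fin p) ℝ)
    (x : EuclideanSpace ℝ (Fin p)) : EuclideanSpace ℝ (ParamIndex p) :=
  paramVec (x - μ, Matrix.vecMulVec (x - μ).ofLp (x - μ).ofLp - S)

/-- The duality behind the limit: the statistic is the Riesz representative of the score for the
information form. With `M = S⁻¹ (covOf v) S⁻¹` and `y = x - μ`, it rests on `tr (M (y yᵀ - S)) = y ⬝
M y - tr (M S)`. -/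
theorem infoForm_centeredStat (μ : EuclideanSpace ℝ (Fin p)) {S : Matrix (Fin p) (Fin p) ℝ}
    (hS : S.IsSymm) (v : EuclideanSpace ℝ (ParamIndex p)) (x : EuclideanSpace ℝ (Fin p)) :
    infoForm S v (centeredStat μ S x) = dirScore S v (x - μ).ofLp := by
  have hinv : (S⁻¹).IsSymm := by rw [Matrix.IsSymm, Matrix.transpose_nonsing_inv, hS.eq]
  have hsymm : (Matrix.vecMulVec (x - μ).ofLp (x - μ).ofLp - S).IsSymm :=
    Matrix.IsSymm.sub (by rw [Matrix.IsSymm, Matrix.transpose_vecMulVec]) hS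
  rw [infoForm_apply, centeredStat, covOf_paramVec hsymm, meanOf_paramVec, dirScore, quadScore,
    Matrix.mul_sub, Matrix.trace_sub, trace_mul_vecMulVec, hinv.dotProduct_mulVec_comm,
    dotProduct_comm (S⁻¹ *ᵥ _)]

/-- Taking the direction `I⁻¹ t` turns the information form into the Euclidean inner product, so all
moments of the statistic are moments of scores. -/
theorem inner_centeredStat (μ : EuclideanSpace ℝ (Fin p)) {S : Matrix (Fin p) (Fin p) ℝ}
    (hS : S.PosDef) (t : EuclideanSpace ℝ (ParamIndex p)) (x : EuclideanSpace ℝ (Fin p)) :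
    inner ℝ t (centeredStat μ S x) =
      dirScore S (WithLp.toLp 2 ((infoMatrix S)⁻¹ *ᵥ t.ofLp)) (x - μ).ofLp := by
  have hF := posDef_infoMatrix hS
  rw [← infoForm_centeredStat μ hS.posSemidef.isSymm, infoForm_comm hS.posSemidef.isSymm,
    ← dotProduct_infoMatrix_mulVec, Matrix.mulVec_mulVec,
    Matrix.mul_nonsing_inv _ (isUnit_iff_ne_zero.mpr hF.det_pos.ne'), Matrix.one_mulVec]
  simp [PiLp.inner_apply, dotProduct]

theorem score_eq {μ : EuclideanSpace ℝ (Fin p)} {S : Matrix (Fin p) (Fin p) ℝ} (hS : S.PosDef)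
    (i : ParamIndex p) (x : EuclideanSpace ℝ (Fin p)) :
    score (paramVec (μ, S)) i x = dirScore S (EuclideanSpace.single i 1) (x - μ).ofLp := by
  have hcov : covOf (paramVec (μ, S)) = S := covOf_paramVec hS.posSemidef.isSymm
  rw [score, partialDeriv, lineDeriv_logDensity (by rw [hcov]; exact hS.det_pos), hcov,
    meanOf_paramVec, dirScore]

theorem fisherInfo_eq {μ : EuclideanSpace ℝ (Fin p)} {S : Matrix (Fin p) (Fin p) ℝ}
    (hS : S.PosDef) : fisherInfo (paramVec (μ, S)) = infoMatrix S := by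
  have hcov : covOf (paramVec (μ, S)) = S := covOf_paramVec hS.posSemidef.isSymm
  ext i j
  rw [fisherInfo, Matrix.of_apply, hcov, meanOf_paramVec, infoMatrix, Matrix.of_apply,
    ← covariance_dirScore μ hS]
  congr 1 <;> funext x <;> exact score_eq hS _ x

theorem memLp_score (μ : EuclideanSpace ℝ (Fin p)) {S : Matrix (Fin p) (Fin p) ℝ} (hS : S.PosDef)
    (i : ParamIndex p) : MemLp (score (paramVec (μ, S)) i) 2 (multivariateGaussian μ S) := by
  rw [show score (paramVec (μ, S)) i = fun x => dirScore S (EuclideanSpace.single i 1) (x - μ).ofLp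
    from funext (score_eq hS i)]
  exact memLp_quadScore μ hS.posSemidef _ _

theorem continuous_paramVec {Z : Type*} [TopologicalSpace Z]
    {f : Z → EuclideanSpace ℝ (Fin p) × Matrix (Fin p) (Fin p) ℝ} (hf : Continuous f) :
    Continuous fun z => paramVec (f z) := by
  refine (PiLp.continuous_toLp 2 _).comp (continuous_pi fun k => ?_)
  rcases k with a | a
  · exact (continuous_apply a).comp ((PiLp.continuous_ofLp 2 _).comp (continuous_fst.comp hf))
  · exact (continuous_apply_apply a.1.1 a.1.2).comp (continuous_snd.comp hf)

theorem continuous_centeredStat (μ : EuclideanSpace ℝ (Fin p)) (S : Matrix (Fin p) (Fin p) ℝ) :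
    Continuous (centeredStat μ S) := by
  refine continuous_paramVec (Continuous.prodMk (by fun_prop) (Continuous.sub ?_ continuous_const))
  exact Continuous.matrix_vecMulVec (by fun_prop) (by fun_prop)

theorem integrable_centeredStat (μ : EuclideanSpace ℝ (Fin p)) {S : Matrix (Fin p) (Fin p) ℝ}
    (hS : S.PosDef) : Integrable (centeredStat μ S) (multivariateGaussian μ S) := by
  refine Integrable.of_eval_piLp fun k => ?_
  have h : ∀ x, centeredStat μ S x k =
      inner ℝ (EuclideanSpace.single k (1 : ℝ)) (centeredStat μ S x) := fun x => by
    simp [EuclideanSpace.inner_single_left]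
  simp_rw [h, inner_centeredStat μ hS]
  exact (memLp_quadScore μ hS.posSemidef _ _).integrable one_le_two

theorem integral_centeredStat (μ : EuclideanSpace ℝ (Fin p)) {S : Matrix (Fin p) (Fin p) ℝ}
    (hS : S.PosDef) : ∫ x, centeredStat μ S x ∂(multivariateGaussian μ S) = 0 := by
  refine ext_inner_left ℝ fun t => ?_
  rw [← integral_inner (integrable_centeredStat μ hS), inner_zero_right]
  simp_rw [inner_centeredStat μ hS]
  exact integral_quadScore μ hS.posSemidef _ _

/-- The score in direction `v = I⁻¹ t` has variance `vᵀ I v`, and `I v = t`. -/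
theorem variance_inner_centeredStat (μ : EuclideanSpace ℝ (Fin p)) {S : Matrix (Fin p) (Fin p) ℝ}
    (hS : S.PosDef) (t : EuclideanSpace ℝ (ParamIndex p)) :
    Var[fun x => inner ℝ t (centeredStat μ S x); multivariateGaussian μ S] =
      t.ofLp ⬝ᵥ ((infoMatrix S)⁻¹ *ᵥ t.ofLp) := by
  have hF := posDef_infoMatrix hS
  have hcont := continuous_centeredStat μ S
  rw [← covariance_self (by fun_prop)]
  simp_rw [inner_centeredStat μ hS]
  rw [covariance_dirScore μ hS, ← dotProduct_infoMatrix_mulVec, Matrix.mulVec_mulVec,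
    Matrix.mul_nonsing_inv _ (isUnit_iff_ne_zero.mpr hF.det_pos.ne'), Matrix.one_mulVec,
    dotProduct_comm]

end GaussianML

/-! ### From averages of the centered statistic to the estimator. -/

namespace GaussianML

variable {p : ℕ}

/-- `w` minus the coordinates of the matrix `meanOf w (meanOf y)ᵀ`. -/
noncomputable def sampleMap (w y : EuclideanSpace ℝ (ParamIndex p)) :
    EuclideanSpace ℝ (ParamIndex p) :=
  w - paramVec (0, Matrix.vecMulVec (meanOf w).ofLp (meanOf y).ofLp)

/-- Lets `√n` act on the first slot alone, while the second keeps the unscaled average that tends to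
zero. -/
theorem sampleMap_smul (c : ℝ) (w y : EuclideanSpace ℝ (ParamIndex p)) :
    sampleMap (c • w) y = c • sampleMap w y := by
  ext k
  rcases k with a | a
  · simp [sampleMap, paramVec]
  · simp [sampleMap, paramVec, meanOf, Matrix.vecMulVec_apply]
    ring

@[simp] theorem sampleMap_zero_right (w : EuclideanSpace ℝ (ParamIndex p)) :
    sampleMap w 0 = w := by
  ext k
  rcases k with a | a <;> simp [sampleMap, paramVec, meanOf, Matrix.vecMulVec_apply]

theorem continuous_meanOf : Continuous (meanOf (p := p)) := by
  unfold meanOf; fun_prop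

theorem continuous_sampleMap :
    Continuous fun z : EuclideanSpace ℝ (ParamIndex p) × EuclideanSpace ℝ (ParamIndex p) =>
      sampleMap z.1 z.2 := by
  have hm := continuous_meanOf (p := p)
  exact continuous_fst.sub (continuous_paramVec (continuous_const.prodMk
    (Continuous.matrix_vecMulVec (by fun_prop) (by fun_prop))))

theorem sampleCov_apply_add {n : ℕ} (hn : n ≠ 0) (x : Fin n → EuclideanSpace ℝ (Fin p))
    (ν : EuclideanSpace ℝ (Fin p)) (a b : Fin p) :
    sampleCov x a b + (sampleMean x - ν) a * (sampleMean x - ν) b =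
      (n : ℝ)⁻¹ * ∑ i, (x i - ν) a * (x i - ν) b := by
  have hn' : (n : ℝ) ≠ 0 := by exact_mod_cast hn
  have hform : ∀ y : Fin p → ℝ, y ⬝ᵥ (Matrix.single b a (1 : ℝ) *ᵥ y) = y a * y b := fun y => by
    rw [Matrix.single_mulVec, one_mul]
    change y ⬝ᵥ Pi.single b (y a) = _
    rw [dotProduct_single, mul_comm]
  have htr : (Matrix.single b a (1 : ℝ) * sampleCov x).trace = sampleCov x a b := by
    simp [Matrix.trace_single_mul]
  -- The quadratic form of this matrix unit is `y a * y b`, so the decomposition is read off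
  -- entrywise.
  have h := sum_quadraticForm hn x ν (Matrix.single b a 1)
  simp_rw [hform] at h
  rw [htr] at h
  rw [h, inv_mul_cancel_left₀ hn']

/-- The sample mean and sample covariance as a function of the mean of the centered statistics. -/
theorem paramVec_sample_sub {n : ℕ} (hn : n ≠ 0) (μ : EuclideanSpace ℝ (Fin p))
    (S : Matrix (Fin p) (Fin p) ℝ) (x : Fin n → EuclideanSpace ℝ (Fin p)) :
    paramVec (sampleMean x, sampleCov x) - paramVec (μ, S) =
      sampleMap ((n : ℝ)⁻¹ • ∑ i, centeredStat μ S (x i))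
        ((n : ℝ)⁻¹ • ∑ i, centeredStat μ S (x i)) := by
  have hn' : (n : ℝ) ≠ 0 := by exact_mod_cast hn
  set y := (n : ℝ)⁻¹ • ∑ i, centeredStat μ S (x i) with hy
  have hmean : ∀ a, y (Sum.inl a) = (sampleMean x - μ) a := fun a => by
    simp [hy, centeredStat, paramVec, sampleMean, Finset.sum_sub_distrib, mul_sub, hn']
  have hcov : ∀ a : {ij : Fin p × Fin p // ij.2 ≤ ij.1}, y (Sum.inr a) =
      sampleCov x a.1.1 a.1.2 + (sampleMean x - μ) a.1.1 * (sampleMean x - μ) a.1.2 -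
        S a.1.1 a.1.2 := fun a => by
    rw [sampleCov_apply_add hn]
    simp [hy, centeredStat, paramVec, Finset.sum_sub_distrib, mul_sub, hn', Matrix.vecMulVec_apply]
  ext k
  rcases k with a | a
  · simp only [sampleMap, PiLp.sub_apply, hmean]
    simp [paramVec]
  · simp only [sampleMap, PiLp.sub_apply, hcov]
    simp only [paramVec, Sum.elim_inr, Matrix.vecMulVec_apply, meanOf, hmean]
    simp only [PiLp.sub_apply]
    ring

section Asymptotics

variable {μ : EuclideanSpace ℝ (Fin p)} {S : Matrix (Fin p) (Fin p) ℝ} {Ω : Type*}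
  [MeasurableSpace Ω] {P : Measure Ω}
  {X : ℕ → Ω → EuclideanSpace ℝ (Fin p)}

theorem identDistrib_centeredStat (hX : ∀ i, HasLaw (X i) (multivariateGaussian μ S) P) (i : ℕ) :
    IdentDistrib (fun w => centeredStat μ S (X i w)) (fun w => centeredStat μ S (X 0 w)) P P :=
  (IdentDistrib.mk (hX i).aemeasurable (hX 0).aemeasurable
    ((hX i).map_eq.trans (hX 0).map_eq.symm)).comp (continuous_centeredStat μ S).measurable

theorem iIndepFun_centeredStat (hindep : iIndepFun X P) :
    iIndepFun (fun i w => centeredStat μ S (X i w)) P :=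
  hindep.comp (fun _ => centeredStat μ S) fun _ => (continuous_centeredStat μ S).measurable

theorem tendsto_mean_centeredStat (hS : S.PosDef)
    (hX : ∀ i, HasLaw (X i) (multivariateGaussian μ S) P) (hindep : iIndepFun X P) :
    ∀ᵐ w ∂P, Tendsto
      (fun n : ℕ => (n : ℝ)⁻¹ • ∑ k ∈ Finset.range n, centeredStat μ S (X k w)) atTop (𝓝 0) := by
  have hint : Integrable (fun w => centeredStat μ S (X 0 w)) P := by
    have h := integrable_centeredStat μ hS
    rw [← (hX 0).map_eq] at h
    exact h.comp_aemeasurable (hX 0).aemeasurable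
  have hzero : ∫ w, centeredStat μ S (X 0 w) ∂P = 0 := by
    rw [← integral_centeredStat μ hS]
    exact (hX 0).integral_comp (continuous_centeredStat μ S).aestronglyMeasurable
  have h := strong_law_ae (fun i w => centeredStat μ S (X i w)) hint
    (fun i j hij => (iIndepFun_centeredStat hindep).indepFun hij) (identDistrib_centeredStat hX)
  rwa [hzero] at h

/-- A maximum likelihood estimator almost surely agrees eventually with the sample mean and the
sample covariance matrix. -/
theorem IsMLEstimator.eventually_eq_sample (hS : S.PosDef)
    (hX : ∀ i, HasLaw (X i) (multivariateGaussian μ S) P) (hindep : iIndepFun X P)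
    {est : ℕ → Ω → EuclideanSpace ℝ (Fin p) × Matrix (Fin p) (Fin p) ℝ}
    (hest : IsMLEstimator P X est) :
    ∀ᵐ w ∂P, ∀ᶠ n : ℕ in atTop, est n w =
      (sampleMean (fun i : Fin n => X i w), sampleCov (fun i : Fin n => X i w)) := by
  have hml : ∀ᵐ w ∂P, ∀ n : ℕ, (∃ θ, IsMLEstimate (fun i : Fin n => X i w) θ) →
      IsMLEstimate (fun i : Fin n => X i w) (est n w) := ae_all_iff.mpr fun n => (hest n).2
  filter_upwards [tendsto_mean_centeredStat hS hX hindep, hml] with w hw hmlw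
  have hcovS : covOf (paramVec (μ, S)) = S := covOf_paramVec hS.posSemidef.isSymm
  -- At the average of the centered statistics this is the determinant of the sample covariance; at
  -- `0` it is `det S > 0`.
  have hdetcont : Continuous fun ψ : EuclideanSpace ℝ (ParamIndex p) =>
      (covOf (paramVec (μ, S) + sampleMap ψ ψ)).det := by
    have h1 : Continuous (covOf (p := p)) :=
      continuous_matrix fun a b => by simp only [covOf, Matrix.of_apply]; fun_prop
    exact (h1.comp (continuous_const.add
      (continuous_sampleMap.comp (continuous_id.prodMk continuous_id)))).matrix_det
  have hlim := (hdetcont.tendsto 0).comp hw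
  simp only [sampleMap_zero_right, add_zero, hcovS] at hlim
  filter_upwards [hlim.eventually_ne hS.det_pos.ne', eventually_ne_atTop 0] with n hdet hn
  set x : Fin n → EuclideanSpace ℝ (Fin p) := fun i => X i w with hx
  have hsum : ∑ k ∈ Finset.range n, centeredStat μ S (X k w) = ∑ i, centeredStat μ S (x i) :=
    (Fin.sum_univ_eq_sum_range (fun k => centeredStat μ S (X k w)) n).symm
  have hC : (sampleCov x).PosDef := by
    rw [posDef_sampleCov_iff]
    simp only [Function.comp_apply] at hdet
    rw [hsum, ← paramVec_sample_sub hn, add_sub_cancel,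
      covOf_paramVec (posSemidef_sampleCov x).isSymm] at hdet
    exact hdet
  -- The explicit maximizer supplies the existence required by the estimator; uniqueness then
  -- identifies the estimate.
  exact (isMLEstimate_iff hn x hC _).mp (hmlw n ⟨_, (isMLEstimate_iff hn x hC _).mpr rfl⟩)

variable [IsProbabilityMeasure P]

theorem tendstoInDistribution_centeredStat (hS : S.PosDef)
    (hX : ∀ i, HasLaw (X i) (multivariateGaussian μ S) P) (hindep : iIndepFun X P) :
    TendstoInDistribution
      (fun (n : ℕ) w => (Real.sqrt n)⁻¹ • ∑ k ∈ Finset.range n, centeredStat μ S (X k w)) atTop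
      (fun z => z) (fun _ => P) (multivariateGaussian 0 (infoMatrix S)⁻¹) := by
  have hcont := continuous_centeredStat μ S
  have hmeas : ∀ t : EuclideanSpace ℝ (ParamIndex p), Measurable
      fun x => (inner ℝ t (centeredStat μ S x) : ℝ) := fun t => by fun_prop
  refine tendstoInDistribution_inv_sqrt_smul_sum (iIndepFun_centeredStat hindep)
    (identDistrib_centeredStat hX) (posDef_infoMatrix hS).inv.posSemidef (fun t => ?_)
    (fun t => ?_) fun t => ?_
  · have h : MemLp (fun x => (inner ℝ t (centeredStat μ S x) : ℝ)) 2
        (multivariateGaussian μ S) := by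
      simp_rw [inner_centeredStat μ hS]
      exact memLp_quadScore μ hS.posSemidef _ _
    rw [← (hX 0).map_eq] at h
    exact h.comp_of_map (hX 0).aemeasurable
  · have h : ∫ x, inner ℝ t (centeredStat μ S x) ∂(multivariateGaussian μ S) = 0 := by
      simp_rw [inner_centeredStat μ hS]
      exact integral_quadScore μ hS.posSemidef _ _
    rw [← h]
    exact (hX 0).integral_comp (hmeas t).aestronglyMeasurable
  · rw [← variance_inner_centeredStat μ hS, ← (hX 0).map_eq,
      variance_map (hmeas t).aemeasurable (hX 0).aemeasurable]
    rfl

/-- Asymptotic normality of the maximum likelihood estimator of a normal distribution. -/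
theorem IsMLEstimator.tendstoInDistribution (hS : S.PosDef)
    (hX : ∀ i, HasLaw (X i) (multivariateGaussian μ S) P) (hindep : iIndepFun X P)
    {est : ℕ → Ω → EuclideanSpace ℝ (Fin p) × Matrix (Fin p) (Fin p) ℝ}
    (hest : IsMLEstimator P X est) :
    TendstoInDistribution
      (fun (n : ℕ) w => Real.sqrt n • (paramVec (est n w) - paramVec (μ, S))) atTop
      (fun z => z) (fun _ => P) (multivariateGaussian 0 (infoMatrix S)⁻¹) := by
  have hstat : ∀ k, AEMeasurable (fun w => centeredStat μ S (X k w)) P := fun k =>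
    (identDistrib_centeredStat hX k).aemeasurable_fst
  have hbar : ∀ n : ℕ, AEMeasurable
      (fun w => (n : ℝ)⁻¹ • ∑ k ∈ Finset.range n, centeredStat μ S (X k w)) P := fun n =>
    (Finset.aemeasurable_fun_sum _ fun k _ => hstat k).fun_const_smul _
  have hbar0 := tendstoInMeasure_of_tendsto_ae (fun n => (hbar n).aestronglyMeasurable)
    (tendsto_mean_centeredStat hS hX hindep)
  -- Slutsky for the pair (scaled average, unscaled average), whose second member tends to `0` in
  -- measure.
  have hslutsky := (tendstoInDistribution_centeredStat hS hX
    hindep).continuous_comp_prodMk_of_tendstoInMeasure_const continuous_sampleMap hbar0 hbar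
  simp only [sampleMap_zero_right] at hslutsky
  have hestm : ∀ n : ℕ, AEMeasurable
      (fun w => Real.sqrt n • (paramVec (est n w) - paramVec (μ, S))) P := fun n =>
    ((hest n).1.sub_const _).fun_const_smul _
  -- Almost surely the two sequences coincide for large `n`, so their difference tends to zero in
  -- measure.
  refine tendstoInDistribution_of_tendstoInMeasure_sub _ _ hslutsky
    (tendstoInMeasure_of_tendsto_ae (fun n =>
      ((hestm n).sub (hslutsky.forall_aemeasurable n)).aestronglyMeasurable) ?_) hestm
  filter_upwards [hest.eventually_eq_sample hS hX hindep] with w hw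
  refine tendsto_const_nhds.congr' ?_
  filter_upwards [hw, eventually_ne_atTop 0] with n hn hn0
  have hn' : (0 : ℝ) < n := by exact_mod_cast Nat.pos_of_ne_zero hn0
  have hsum : ∑ k ∈ Finset.range n, centeredStat μ S (X k w) =
      ∑ i : Fin n, centeredStat μ S (X i w) :=
    (Fin.sum_univ_eq_sum_range (fun k => centeredStat μ S (X k w)) n).symm
  have hsqrt : (Real.sqrt n)⁻¹ = Real.sqrt n * (n : ℝ)⁻¹ := by
    have := Real.sqrt_pos.mpr hn'
    field_simp
    exact (Real.sq_sqrt hn'.le).symm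
  simp only [Pi.sub_apply, Pi.zero_apply]
  rw [hn, paramVec_sample_sub hn0, hsum, hsqrt, mul_smul, sampleMap_smul (Real.sqrt n),
    sub_self]

end Asymptotics

end GaussianML

/-! ### Assembly of the result. -/

theorem theorem2 {p : ℕ}
    (μ : EuclideanSpace ℝ (Fin p)) (S : Matrix (Fin p) (Fin p) ℝ) (hS : S.PosDef)
    {Ω : Type*} [MeasurableSpace Ω] (P : Measure Ω) [IsProbabilityMeasure P]
    (X : ℕ → Ω → EuclideanSpace ℝ (Fin p))
    (hX : ∀ i, HasLaw (X i) (multivariateGaussian μ S) P)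
    (hindep : iIndepFun X P)
    (est : ℕ → Ω → EuclideanSpace ℝ (Fin p) × Matrix (Fin p) (Fin p) ℝ)
    (hest : GaussianML.IsMLEstimator P X est) :
    -- the dimension
    Module.finrank ℝ (EuclideanSpace ℝ (Fin p) × GaussianML.symMatrices p) = p * (p + 3) / 2 ∧
    Fintype.card (GaussianML.ParamIndex p) = p * (p + 3) / 2 ∧
    -- the Fisher information is well defined
    (∀ x, DifferentiableAt ℝ (fun ψ => GaussianML.logDensity ψ x) (GaussianML.paramVec (μ, S))) ∧
    (∀ i, MemLp (GaussianML.score (GaussianML.paramVec (μ, S)) i) 2 (multivariateGaussian μ S)) ∧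
    -- its formula
    (∀ i j, GaussianML.fisherInfo (GaussianML.paramVec (μ, S)) i j =
      GaussianML.meanPartial (GaussianML.paramVec (μ, S)) i ⬝ᵥ
          (S⁻¹ *ᵥ GaussianML.meanPartial (GaussianML.paramVec (μ, S)) j) +
        1 / 2 * (S⁻¹ * GaussianML.covPartial (GaussianML.paramVec (μ, S)) i *
          S⁻¹ * GaussianML.covPartial (GaussianML.paramVec (μ, S)) j).trace) ∧
    -- it is invertible
    (GaussianML.fisherInfo (GaussianML.paramVec (μ, S))).PosDef ∧
    -- asymptotic normality
    TendstoInDistribution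
      (fun (n : ℕ) w =>
        Real.sqrt n • (GaussianML.paramVec (est n w) - GaussianML.paramVec (μ, S)))
      atTop
      (fun z : EuclideanSpace ℝ (GaussianML.ParamIndex p) => z)
      (fun _ => P)
      (multivariateGaussian 0 (GaussianML.fisherInfo (GaussianML.paramVec (μ, S)))⁻¹) := by
  have hsymm := hS.posSemidef.isSymm
  have hcov : GaussianML.covOf (GaussianML.paramVec (μ, S)) = S := GaussianML.covOf_paramVec hsymm
  rw [GaussianML.fisherInfo_eq hS]
  refine ⟨GaussianML.finrank_prod_symMatrices p, GaussianML.card_paramIndex p,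
    GaussianML.differentiableAt_logDensity (by rw [hcov]; exact hS.det_pos),
    GaussianML.memLp_score μ hS, fun i j => ?_, GaussianML.posDef_infoMatrix hS,
    hest.tendstoInDistribution hS hX hindep⟩
  -- Mean and covariance are linear in the coordinates, so their partials are their values at basis
  -- vectors, as in `infoMatrix`.
  simp only [GaussianML.meanPartial_eq, GaussianML.covPartial_eq]
  rfl
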